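/- Let $\mathcal S,\mathcal A$ be finite sets, $\gamma\in(0,1)$, $\lambda\ge 0$, and let $\rho$ be a probability distribution on $\mathcal S$. Let $\Pi$ be the set of policies, i.e. of vectors $\pi=(\pi(a|s))_{s,a}$ with nonnegative entries and $\sum_a\pi(a|s)=1$ for every $s$, and let $\mathcal P$ be the set of transition kernels, i.e. of vectors $p=(p(s'|s,a))_{s,a,s'}$ with nonnegative entries and $\sum_{s'}p(s'|s,a)=1$ for all $s,a$. All norms are Euclidean. To every $\pi\in\Pi$ there are attached a transition kernel $p_\pi\in\mathcal P$ and a reward $r_\pi\in[0,1]^{\mathcal S\times\mathcal A}$. For $\pi\in\Pi$ and $p\in\mathcal P$ let $\mathbb P_{\pi,p,\rho}$ be the law of the process with $s_0\sim\rho$, $a_t\sim\pi(\cdot|s_t)$, $s_{t+1}\sim p(\cdot|s_t,a_t)$, and let $$d_{\pi,p}(s)=\sum_a(1-\gamma)\sum_{t\ge 0}\gamma^t\,\mathbb P_{\pi,p,\rho}\{s_t=s,a_t=a\},\qquad V(\pi)=\mathbb E_{\pi,p_\pi,\rho}\Big[\sum_{t\ge 0}\gamma^t\big(r_\pi(s_t,a_t)-\lambda\log\pi(a_t|s_t)\big)\Big].$$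 Gradients of functions on $\Pi$ are gradients relative to $\Pi$: $g$ is a gradient of $f$ at $\pi_0\in\Pi$ if $f(\pi)=f(\pi_0)+\langle g,\pi-\pi_0\rangle+o(\|\pi-\pi_0\|)$ as $\pi\to\pi_0$ in $\Pi$; the numbers $\langle g,\pi-\pi_0\rangle$, $\pi\in\Pi$, do not depend on the choice of $g$. Assume that there are constants $\epsilon_p,\epsilon_r,S_p,S_r,D>0$ such that (1) (sensitivity) $\|p_{\pi'}-p_\pi\|\le\epsilon_p\|\pi'-\pi\|$ and $\|r_{\pi'}-r_\pi\|\le\epsilon_r\|\pi'-\pi\|$ for all $\pi,\pi'\in\Pi$; (2) (smoothness) for all $s,a,s'$ the functions $\pi\mapsto p_\pi(s'|s,a)$ and $\pi\mapsto r_\pi(s,a)$ are differentiable on $\Pi$, with gradients that are Lipschitz on $\Pi$ with constants $S_p$ and $S_r$ respectively; (3) (state occupancy) $d_{\pi,p}(s)\ge D$ for all $\pi\in\Pi$, $p\in\mathcal P$, $s\in\mathcal S$. Then for all $\pi_0,\pi_1\in\Pi$ $$V(\pi_1)\le V(\pi_0)+D^{-1}\max_{\pi\in\Pi}\langle\nabla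 V(\pi_0),\pi-\pi_0\rangle-\frac{\mu}{2}\|\pi_1-\pi_0\|^2,$$ where $$\mu=\frac{D\lambda}{1-\gamma}-\frac{6\gamma|\mathcal S|(1+\lambda\log|\mathcal A|)}{D(1-\gamma)^3}\Big[\epsilon_p\big(\sqrt{|\mathcal A|}+\gamma\epsilon_p\sqrt{|\mathcal S|}\big)+S_p(1-\gamma)\Big]-\frac{S_r(1-\gamma)+4\epsilon_r\big(\sqrt{|\mathcal A|}+\epsilon_p\sqrt{|\mathcal S|}\big)}{D^2(1-\gamma)^2}.$$ Precisely: the inequality, with the maximum attained, holds for every $\pi_1\in\Pi$ whenever $V$ has a gradient at $\pi_0\in\Pi$; $V$ has a gradient at $\pi_0$ if $\lambda=0$ or if all entries of $\pi_0$ are positive; and if $\lambda>0$ and $\pi_0$ has a zero entry, then some $\pi\in\Pi$ satisfies $\lim_{t\to0^+}\big(V(\pi_0+t(\pi-\pi_0))-V(\pi_0)\big)/t=+\infty$, so that the maximum is to be read as $+\infty$. -/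

import Mathlib

open MeasureTheory ProbabilityTheory Set Filter Topology

noncomputable section

/-- Vectors with one real entry per state-action pair, with the Euclidean norm. A policy is such a
vector `π`, the entry `π (s, a)` being `π(a|s)`; a reward function is one with entries `r(s,a)`. -/
abbrev SAVec (S A : Type*) : Type _ := EuclideanSpace ℝ (S × A)

/-- Vectors with one real entry per triple `(s, a, s')`, with the Euclidean norm. The entry
`p (s, a, s')` of a transition kernel `p` is `p(s'|s,a)`. -/
abbrev KernelVec (S A : Type*) : Type _ := EuclideanSpace ℝ (S × A × S)

section Defs

variable {S A : Type*} [Fintype S] [Fintype A]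

/-- The policy space `Π`. -/
def policySpace (S A : Type*) [Fintype S] [Fintype A] : Set (SAVec S A) :=
  {π | (∀ x, 0 ≤ π x) ∧ ∀ s, ∑ a, π (s, a) = 1}

/-- The space `𝒫` of transition kernels. -/
def kernelSpace (S A : Type*) [Fintype S] [Fintype A] : Set (KernelVec S A) :=
  {p | (∀ x, 0 ≤ p x) ∧ ∀ s a, ∑ s', p (s, a, s') = 1}

/-- The space `ℛ` of reward functions with values in `[0,1]`. -/
def rewardSpace (S A : Type*) [Fintype S] [Fintype A] : Set (SAVec S A) :=
  {r | ∀ x, r x ∈ Icc (0 : ℝ) 1}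

/-- The measure on a finite set with the given point weights. -/
def weightMeasure {X : Type*} [Fintype X] [MeasurableSpace X] (w : X → ℝ) : Measure X :=
  ∑ x, ENNReal.ofReal (w x) • Measure.dirac x

theorem isProbabilityMeasure_weightMeasure {X : Type*} [Fintype X] [MeasurableSpace X]
    {w : X → ℝ} (h0 : ∀ x, 0 ≤ w x) (h1 : ∑ x, w x = 1) :
    IsProbabilityMeasure (weightMeasure w) := by
  constructor
  simp only [weightMeasure, Measure.coe_finsetSum, Finset.sum_apply, Measure.smul_apply,
    measure_univ, smul_eq_mul, mul_one]
  rw [← ENNReal.ofReal_sum_of_nonneg (fun x _ => h0 x), h1, ENNReal.ofReal_one]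

/-- Weights of the law of `(s₀, a₀)`: `s₀ ∼ ρ`, `a₀ ∼ π(·|s₀)`. -/
def initWeight (ρ : S → ℝ) (π : SAVec S A) (y : S × A) : ℝ := ρ y.1 * π y

/-- Weights of the law of `(s_{t+1}, a_{t+1})` given `(s_t, a_t) = x`:
`s_{t+1} ∼ p(·|s_t, a_t)`, `a_{t+1} ∼ π(·|s_{t+1})`. -/
def stepWeight (π : SAVec S A) (p : KernelVec S A) (x y : S × A) : ℝ :=
  p (x.1, x.2, y.1) * π y

theorem isProbabilityMeasure_initWeight [MeasurableSpace S] [MeasurableSpace A]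
    {ρ : S → ℝ} {π : SAVec S A} (hρ : ρ ∈ stdSimplex ℝ S) (hπ : π ∈ policySpace S A) :
    IsProbabilityMeasure (weightMeasure (initWeight ρ π)) := by
  refine isProbabilityMeasure_weightMeasure (fun y => mul_nonneg (hρ.1 _) (hπ.1 _)) ?_
  simp only [initWeight, Fintype.sum_prod_type, ← Finset.mul_sum, hπ.2, mul_one]
  exact hρ.2

theorem isProbabilityMeasure_stepWeight [MeasurableSpace S] [MeasurableSpace A]
    {π : SAVec S A} {p : KernelVec S A} (hπ : π ∈ policySpace S A) (hp : p ∈ kernelSpace S A)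
    (x : S × A) : IsProbabilityMeasure (weightMeasure (stepWeight π p x)) := by
  refine isProbabilityMeasure_weightMeasure (fun y => mul_nonneg (hp.1 _) (hπ.1 _)) ?_
  simp only [stepWeight, Fintype.sum_prod_type, ← Finset.mul_sum, hπ.2, mul_one]
  exact hp.2 _ _

variable [MeasurableSpace S] [DiscreteMeasurableSpace S]
  [MeasurableSpace A] [DiscreteMeasurableSpace A]

/-- The one-step kernel of the Markov chain `(s_t, a_t)`. -/
def stepKernel (π : SAVec S A) (p : KernelVec S A) : Kernel (S × A) (S × A) :=
  Kernel.ofFunOfCountable fun x => weightMeasure (stepWeight π p x)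

/-- The same kernel, as a function of the whole history up to time `n`. -/
def histKernel (π : SAVec S A) (p : KernelVec S A) (n : ℕ) :
    Kernel (∀ _ : Finset.Iic n, S × A) (S × A) :=
  (stepKernel π p).comap (fun h => h ⟨n, Finset.mem_Iic.2 le_rfl⟩) (measurable_pi_apply _)

theorem isMarkovKernel_histKernel {π : SAVec S A} {p : KernelVec S A}
    (hπ : π ∈ policySpace S A) (hp : p ∈ kernelSpace S A) (n : ℕ) :
    IsMarkovKernel (histKernel π p n) :=
  ⟨fun h => isProbabilityMeasure_stepWeight hπ hp (h ⟨n, Finset.mem_Iic.2 le_rfl⟩)⟩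

open Classical in
/-- The law `ℙ_{π,p,ρ}` of the trajectory `t ↦ (s_t, a_t)`: the Ionescu-Tulcea measure of the chain.
Only distributions `ρ`, policies `π` and transition kernels `p` matter; the value `0` outside of
them is a placeholder. -/
def trajLaw (ρ : S → ℝ) (π : SAVec S A) (p : KernelVec S A) : Measure (ℕ → S × A) :=
  if h : ρ ∈ stdSimplex ℝ S ∧ π ∈ policySpace S A ∧ p ∈ kernelSpace S A then
    haveI := isProbabilityMeasure_initWeight h.1 h.2.1
    haveI := isMarkovKernel_histKernel h.2.1 h.2.2
    Kernel.trajMeasure (X := fun _ => S × A) (weightMeasure (initWeight ρ π)) (histKernel π p)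
  else 0

/-- The occupancy measure `d_{π,p}(s,a) = (1-γ) ∑_t γ^t ℙ_{π,p,ρ}{s_t = s, a_t = a}`. -/
def occupancy (γ : ℝ) (ρ : S → ℝ) (π : SAVec S A) (p : KernelVec S A) (x : S × A) : ℝ :=
  (1 - γ) * ∑' t : ℕ, γ ^ t * (trajLaw ρ π p).real {ω | ω t = x}

/-- The state occupancy measure `d_{π,p}(s) = ∑_a d_{π,p}(s,a)`. -/
def stateOccupancy (γ : ℝ) (ρ : S → ℝ) (π : SAVec S A) (p : KernelVec S A) (s : S) : ℝ :=
  ∑ a, occupancy γ ρ π p (s, a)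

/-- The entropy-regularized value of policy `π` for transition kernel `p` and reward `r`,
`𝔼_{π,p,ρ}[∑_t γ^t (r(s_t,a_t) - λ log π(a_t|s_t))]`. -/
def entropyValue (γ lam : ℝ) (ρ : S → ℝ) (π : SAVec S A) (p : KernelVec S A) (r : SAVec S A) : ℝ :=
  ∫ ω, ∑' t : ℕ, γ ^ t * (r (ω t) - lam * Real.log (π (ω t))) ∂(trajLaw ρ π p)

/-- The performative value function `π ↦ V_{λ,π}^π`, the environment being `p_π` and `r_π`. -/
def performativeValue (γ lam : ℝ) (ρ : S → ℝ) (p : SAVec S A → KernelVec S A)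
    (r : SAVec S A → SAVec S A) (π : SAVec S A) : ℝ :=
  entropyValue γ lam ρ π (p π) (r π)

end Defs

/-- `f` is differentiable on `K` and its gradient is `L`-Lipschitz on `K`. (Differentiability is
relative to `K`, since the environment is defined on policies only.) -/
def LipschitzSmoothOn {E : Type*} [NormedAddCommGroup E] [InnerProductSpace ℝ E] [CompleteSpace E]
    (f : E → ℝ) (K : Set E) (L : ℝ) : Prop :=
  ∃ g : E → E, (∀ x ∈ K, HasGradientWithinAt f (g x) K x) ∧
    ∀ x ∈ K, ∀ y ∈ K, ‖g y - g x‖ ≤ L * ‖y - x‖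

/-- The constant `μ`, with `nS = |𝒮|` and `nA = |𝒜|`. -/
def gradDomConst (γ lam D εp εr Sp Sr nS nA : ℝ) : ℝ :=
  D * lam / (1 - γ)
    - 6 * γ * nS * (1 + lam * Real.log nA) / (D * (1 - γ) ^ 3)
      * (εp * (√nA + γ * εp * √nS) + Sp * (1 - γ))
    - (Sr * (1 - γ) + 4 * εr * (√nA + εp * √nS)) / (D ^ 2 * (1 - γ) ^ 2)

end

/-! Fix `π₀` and take the solution of its regularized Bellman equation in its own environment.
Pairing the flow equation of the occupancy measures with this function gives an exact formula for
the value difference (`entropyValue_sub`), weighted by the occupancy of the new policy: a policy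
term with the environment frozen at `π₀`, plus an environment term in which only the one-step return
changes and the Bellman solution stays fixed.

In the policy term, entropy differences are a linear part in `u = π₁ - π₀` minus `λ` times Bregman
divergences of `x log x`. Each divergence is at least half a square (`half_sq_sub_le_bregman`),
which with the bound `D` on state occupancies yields the positive term of `μ`.

The linear part carries the state weights `d₁(s)` of `π₁`, while the gradient at `π₀` carries
`d₀(s)`. Rescaling row `s` of `u` by `d₁(s)/d₀(s)` gives a vector `v` that absorbs this mismatch
exactly. Since `D * d₁(s)/d₀(s) ≤ 1` and the rows of a policy can be mixed independently, `π₀ + D •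
v` is again a policy, so the gradient pairs with `v` to at most `D⁻¹` times the maximum. The
environment term differs from its linearization along `v` by a quantity of second order, because the
environment is smooth and occupancies are Lipschitz (`environment_error_le`,
`environment_const_le`); this accounts for the negative terms of `μ`.

The same formula settles differentiability. If `λ = 0` or `π₀` is positive, everything nonlinear is
`O(‖u‖²)`; at a zero entry, the infinite slope of `-x log x` dominates the other terms. -/

/-! ### Trajectory law, occupancy measures and their flow equation. -/

section Trajectory

variable {S A : Type*} [Fintype S] [Fintype A]

theorem weightMeasure_real_singleton {X : Type*} [Fintype X] [MeasurableSpace X]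
    [MeasurableSingletonClass X] {w : X → ℝ} (h0 : ∀ x, 0 ≤ w x) (y : X) :
    (weightMeasure w).real {y} = w y := by
  classical
  simp only [weightMeasure, measureReal_def, Measure.coe_finsetSum, Finset.sum_apply,
    Measure.smul_apply, smul_eq_mul, Measure.dirac_apply' _ (measurableSet_singleton y)]
  rw [Finset.sum_eq_single y]
  · simp [h0 y]
  · intro b _ hb
    simp [indicator, hb]
  · simp

variable [MeasurableSpace S] [DiscreteMeasurableSpace S]
  [MeasurableSpace A] [DiscreteMeasurableSpace A]
  {ρ : S → ℝ} {π : SAVec S A} {p : KernelVec S A}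

theorem trajMeasure_map_zero {X : Type*} [MeasurableSpace X]
    (μ₀ : Measure X) [IsProbabilityMeasure μ₀]
    (κ : (n : ℕ) → Kernel (∀ _ : Finset.Iic n, X) X) [∀ n, IsMarkovKernel (κ n)] :
    (Kernel.trajMeasure (X := fun _ => X) μ₀ κ).map (fun ω => ω 0) = μ₀ := by
  let e : (∀ _ : Finset.Iic 0, X) ≃ᵐ X := MeasurableEquiv.piUnique (fun _ : Finset.Iic 0 => X)
  have h : (Kernel.trajMeasure (X := fun _ => X) μ₀ κ).map (Preorder.frestrictLe 0) =
      μ₀.map e.symm := by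
    rw [Kernel.trajMeasure, Measure.map_comp _ _ (by fun_prop), Kernel.traj_map_frestrictLe,
      Kernel.partialTraj_self, Measure.id_comp]
  have h2 := Measure.map_map (μ := Kernel.trajMeasure (X := fun _ => X) μ₀ κ) e.measurable
    (f := Preorder.frestrictLe (π := fun _ => X) 0) (by fun_prop)
  rw [h, MeasurableEquiv.map_map_symm] at h2
  exact h2.symm

theorem isProbabilityMeasure_trajLaw (hρ : ρ ∈ stdSimplex ℝ S) (hπ : π ∈ policySpace S A)
    (hp : p ∈ kernelSpace S A) : IsProbabilityMeasure (trajLaw ρ π p) := by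
  rw [trajLaw, dif_pos ⟨hρ, hπ, hp⟩]
  have := isProbabilityMeasure_initWeight hρ hπ
  have := isMarkovKernel_histKernel hπ hp
  infer_instance

theorem trajLaw_real_zero (hρ : ρ ∈ stdSimplex ℝ S) (hπ : π ∈ policySpace S A)
    (hp : p ∈ kernelSpace S A) (x : S × A) :
    (trajLaw ρ π p).real {ω | ω 0 = x} = initWeight ρ π x := by
  rw [trajLaw, dif_pos ⟨hρ, hπ, hp⟩]
  have := isProbabilityMeasure_initWeight hρ hπ
  have := isMarkovKernel_histKernel hπ hp
  have h := trajMeasure_map_zero (X := S × A) (weightMeasure (initWeight ρ π))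
    (histKernel π p)
  have h2 := congrArg (fun ν => ν.real {x}) h
  beta_reduce at h2
  rw [map_measureReal_apply (by fun_prop) (measurableSet_singleton x),
    weightMeasure_real_singleton (w := initWeight ρ π)
      (fun y => mul_nonneg (hρ.1 _) (hπ.1 _)) x] at h2
  exact h2

/-- The joint law of the history up to `t` and the next pair is the history law composed with
`histKernel`, which sees only the last pair; integrating out the rest leaves a sum over the marginal
at time `t`. -/
theorem trajLaw_real_succ (hρ : ρ ∈ stdSimplex ℝ S) (hπ : π ∈ policySpace S A)
    (hp : p ∈ kernelSpace S A) (t : ℕ) (y : S × A) :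
    (trajLaw ρ π p).real {ω | ω (t + 1) = y} =
      ∑ x, (trajLaw ρ π p).real {ω | ω t = x} * stepWeight π p x y := by
  have := isProbabilityMeasure_trajLaw hρ hπ hp
  have := isProbabilityMeasure_initWeight hρ hπ
  have := isMarkovKernel_histKernel hπ hp
  have key : (trajLaw ρ π p) {ω | ω (t + 1) = y} =
      ∫⁻ ω, weightMeasure (stepWeight π p (ω t)) {y} ∂(trajLaw ρ π p) := by
    have h := Kernel.map_frestrictLe_trajMeasure_compProd_eq_map_trajMeasure
      (X := fun _ => S × A) (μ₀ := weightMeasure (initWeight ρ π)) (κ := histKernel π p) (a := t)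
    rw [trajLaw, dif_pos ⟨hρ, hπ, hp⟩]
    have h2 := congrArg (fun ν => ν (univ ×ˢ {y})) h
    beta_reduce at h2
    rw [Measure.compProd_apply_prod MeasurableSet.univ (measurableSet_singleton y),
      Measure.map_apply (by fun_prop) (MeasurableSet.univ.prod (measurableSet_singleton y)),
      Measure.restrict_univ, lintegral_map (Kernel.measurable_coe _ (measurableSet_singleton y))
        (by fun_prop)] at h2
    rw [show {ω : ℕ → S × A | ω (t + 1) = y} = (fun x : ℕ → S × A =>
      (Preorder.frestrictLe (π := fun _ => S × A) t x, x (t + 1))) ⁻¹' (univ ×ˢ {y}) by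
        ext; simp, ← h2]
    rfl
  have hmeas : Measurable fun ω : ℕ → S × A => ω t := measurable_pi_apply t
  rw [measureReal_def, key]
  have h3 := lintegral_map (μ := trajLaw ρ π p)
    (f := fun x => weightMeasure (stepWeight π p x) {y}) (Measurable.of_discrete) hmeas
  beta_reduce at h3
  rw [← h3, lintegral_fintype, ENNReal.toReal_sum]
  · refine Finset.sum_congr rfl fun x _ => ?_
    rw [ENNReal.toReal_mul, ← weightMeasure_real_singleton (w := stepWeight π p x)
      (fun y => mul_nonneg (hp.1 _) (hπ.1 _)) y, mul_comm,
      Measure.map_apply hmeas (measurableSet_singleton x)]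
    rfl
  · intro x _
    have := isProbabilityMeasure_stepWeight hπ hp x
    have := Measure.isProbabilityMeasure_map (μ := trajLaw ρ π p) hmeas.aemeasurable
    exact ENNReal.mul_ne_top (measure_ne_top _ _) (measure_ne_top _ _)

theorem sum_trajLaw_real (hρ : ρ ∈ stdSimplex ℝ S) (hπ : π ∈ policySpace S A)
    (hp : p ∈ kernelSpace S A) (t : ℕ) :
    ∑ x, (trajLaw ρ π p).real {ω | ω t = x} = 1 := by
  have := isProbabilityMeasure_trajLaw hρ hπ hp
  have h := sum_measureReal_preimage_singleton (μ := trajLaw ρ π p) (Finset.univ : Finset (S × A))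
    (f := fun ω : ℕ → S × A => ω t)
    (fun y _ => measurable_pi_apply t (measurableSet_singleton y))
  simp only [Finset.coe_univ, preimage_univ, probReal_univ] at h
  exact h

theorem integral_trajLaw (hρ : ρ ∈ stdSimplex ℝ S) (hπ : π ∈ policySpace S A)
    (hp : p ∈ kernelSpace S A) (f : S × A → ℝ) (t : ℕ) :
    ∫ ω, f (ω t) ∂(trajLaw ρ π p) = ∑ x, (trajLaw ρ π p).real {ω | ω t = x} * f x := by
  have := isProbabilityMeasure_trajLaw hρ hπ hp
  have hmeas : Measurable fun ω : ℕ → S × A => ω t := measurable_pi_apply t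
  have := Measure.isProbabilityMeasure_map (μ := trajLaw ρ π p) hmeas.aemeasurable
  rw [← integral_map (f := f) hmeas.aemeasurable
    (Measurable.of_discrete.aestronglyMeasurable), integral_fintype (Integrable.of_finite)]
  refine Finset.sum_congr rfl fun x _ => ?_
  rw [map_measureReal_apply hmeas (measurableSet_singleton x), smul_eq_mul]
  rfl

variable {γ : ℝ}

theorem summable_trajLaw (hγ0 : 0 < γ) (hγ1 : γ < 1)
    (hρ : ρ ∈ stdSimplex ℝ S) (hπ : π ∈ policySpace S A)
    (hp : p ∈ kernelSpace S A) (x : S × A) :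
    Summable fun t : ℕ => γ ^ t * (trajLaw ρ π p).real {ω | ω t = x} := by
  have := isProbabilityMeasure_trajLaw hρ hπ hp
  refine Summable.of_nonneg_of_le (fun t => by positivity) (fun t => ?_)
    (summable_geometric_of_lt_one hγ0.le hγ1)
  exact mul_le_of_le_one_right (by positivity) measureReal_le_one

theorem occupancy_nonneg (hγ0 : 0 < γ) (hγ1 : γ < 1) (x : S × A) :
    0 ≤ occupancy γ ρ π p x :=
  mul_nonneg (by linarith) (tsum_nonneg fun t => by positivity)

/-- The summand is a function on a finite set, hence bounded, even with the convention `log 0 = 0`.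
The geometric weights then allow sum and integral to be exchanged. -/
theorem entropyValue_eq (lam : ℝ) (hγ0 : 0 < γ) (hγ1 : γ < 1)
    (hρ : ρ ∈ stdSimplex ℝ S) (hπ : π ∈ policySpace S A)
    (hp : p ∈ kernelSpace S A) (r : SAVec S A) :
    (1 - γ) * entropyValue γ lam ρ π p r =
      ∑ x, occupancy γ ρ π p x * (r x - lam * Real.log (π x)) := by
  have := isProbabilityMeasure_trajLaw hρ hπ hp
  set f : S × A → ℝ := fun x => r x - lam * Real.log (π x) with hf
  have hfm (t : ℕ) : Measurable fun ω : ℕ → S × A => f (ω t) :=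
    (Measurable.of_discrete (f := f)).comp (measurable_pi_apply t)
  have hfb (x) : ‖f x‖ ≤ ∑ y, ‖f y‖ :=
    Finset.single_le_sum (f := fun y => ‖f y‖) (fun _ _ => norm_nonneg _) (Finset.mem_univ x)
  have hint (t : ℕ) : Integrable (fun ω : ℕ → S × A => f (ω t)) (trajLaw ρ π p) :=
    Integrable.of_bound (hfm t).aestronglyMeasurable (∑ y, ‖f y‖) (ae_of_all _ fun ω => hfb _)
  have h := integral_tsum_of_summable_integral_norm (μ := trajLaw ρ π p)
    (F := fun t ω => γ ^ t * f (ω t)) (fun t => (hint t).const_mul _) (by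
      refine Summable.of_nonneg_of_le (fun t => integral_nonneg fun ω => norm_nonneg _)
        (fun t => ?_) ((summable_geometric_of_lt_one hγ0.le hγ1).mul_right (∑ y, ‖f y‖))
      calc ∫ ω, ‖γ ^ t * f (ω t)‖ ∂(trajLaw ρ π p)
          ≤ ∫ ω, γ ^ t * ∑ y, ‖f y‖ ∂(trajLaw ρ π p) := by
            refine integral_mono ((hint t).const_mul _).norm (integrable_const _) fun ω => ?_
            simp only [norm_mul, norm_pow, Real.norm_of_nonneg hγ0.le]
            exact mul_le_mul_of_nonneg_left (hfb _) (by positivity)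
        _ = _ := by simp)
  rw [entropyValue, ← h]
  simp only [integral_const_mul, integral_trajLaw hρ hπ hp f, Finset.mul_sum, ← mul_assoc]
  rw [Summable.tsum_finsetSum fun x _ => (summable_trajLaw hγ0 hγ1 hρ hπ hp x).mul_right _,
    Finset.mul_sum]
  refine Finset.sum_congr rfl fun x _ => ?_
  rw [occupancy, tsum_mul_right, mul_assoc]

theorem sum_occupancy (hγ0 : 0 < γ) (hγ1 : γ < 1)
    (hρ : ρ ∈ stdSimplex ℝ S) (hπ : π ∈ policySpace S A) (hp : p ∈ kernelSpace S A) :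
    ∑ x, occupancy γ ρ π p x = 1 := by
  simp only [occupancy]
  rw [← Finset.mul_sum,
    ← Summable.tsum_finsetSum fun x _ => (summable_trajLaw hγ0 hγ1 hρ hπ hp x)]
  simp only [← Finset.mul_sum, sum_trajLaw_real hρ hπ hp, mul_one]
  rw [tsum_geometric_of_lt_one hγ0.le hγ1, mul_inv_cancel₀ (by linarith)]

theorem occupancy_flow (hγ0 : 0 < γ) (hγ1 : γ < 1)
    (hρ : ρ ∈ stdSimplex ℝ S) (hπ : π ∈ policySpace S A) (hp : p ∈ kernelSpace S A) (y : S × A) :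
    occupancy γ ρ π p y = (1 - γ) * initWeight ρ π y
      + γ * ∑ x, occupancy γ ρ π p x * stepWeight π p x y := by
  have hs := summable_trajLaw (γ := γ) hγ0 hγ1 hρ hπ hp
  rw [occupancy, (hs y).tsum_eq_zero_add]
  simp only [trajLaw_real_succ hρ hπ hp, trajLaw_real_zero hρ hπ hp, Finset.mul_sum, occupancy,
    pow_succ, pow_zero, one_mul]
  rw [Summable.tsum_finsetSum, mul_add, Finset.mul_sum]
  · congr 1
    refine Finset.sum_congr rfl fun x _ => ?_
    have (t : ℕ) : γ ^ t * γ * ((trajLaw ρ π p).real {ω | ω t = x} * stepWeight π p x y)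
        = γ ^ t * (trajLaw ρ π p).real {ω | ω t = x} * (γ * stepWeight π p x y) := by ring
    simp only [this, tsum_mul_right]
    ring
  · intro x _
    have := (hs x).mul_right (γ * stepWeight π p x y)
    refine this.congr fun t => by ring

theorem stateOccupancy_flow (hγ0 : 0 < γ) (hγ1 : γ < 1)
    (hρ : ρ ∈ stdSimplex ℝ S) (hπ : π ∈ policySpace S A) (hp : p ∈ kernelSpace S A) (s : S) :
    stateOccupancy γ ρ π p s =
      (1 - γ) * ρ s + γ * ∑ x : S × A, occupancy γ ρ π p x * p (x.1, x.2, s) := by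
  rw [stateOccupancy]
  have (a : A) : (1 - γ) * (ρ s * π (s, a))
      + γ * ∑ x : S × A, occupancy γ ρ π p x * (p (x.1, x.2, s) * π (s, a)) =
      ((1 - γ) * ρ s + γ * ∑ x : S × A, occupancy γ ρ π p x * p (x.1, x.2, s)) * π (s, a) := by
    rw [add_mul, mul_assoc, mul_assoc, Finset.sum_mul]
    simp only [mul_assoc]
  have h2 : ∀ a : A, occupancy γ ρ π p (s, a) = _ := fun a =>
    (occupancy_flow hγ0 hγ1 hρ hπ hp (s, a)).trans (this a)
  calc _ = ∑ a, ((1 - γ) * ρ s + γ * ∑ x : S × A, occupancy γ ρ π p x * p (x.1, x.2, s))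
        * π (s, a) := Finset.sum_congr rfl fun a _ => by
          exact h2 a
    _ = _ := by rw [← Finset.mul_sum, hπ.2, mul_one]

/-- Both terms on the right of the flow equation contain the factor `π x`, and what remains is the
flow equation for states. -/
theorem occupancy_eq (hγ0 : 0 < γ) (hγ1 : γ < 1)
    (hρ : ρ ∈ stdSimplex ℝ S) (hπ : π ∈ policySpace S A) (hp : p ∈ kernelSpace S A) (x : S × A) :
    occupancy γ ρ π p x = stateOccupancy γ ρ π p x.1 * π x := by
  rw [occupancy_flow hγ0 hγ1 hρ hπ hp, stateOccupancy_flow hγ0 hγ1 hρ hπ hp, add_mul,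
    mul_assoc, mul_assoc, Finset.sum_mul]
  simp only [initWeight, stepWeight, mul_assoc]

theorem sum_stateOccupancy (hγ0 : 0 < γ) (hγ1 : γ < 1)
    (hρ : ρ ∈ stdSimplex ℝ S) (hπ : π ∈ policySpace S A) (hp : p ∈ kernelSpace S A) :
    ∑ s, stateOccupancy γ ρ π p s = 1 := by
  rw [← sum_occupancy hγ0 hγ1 hρ hπ hp, Fintype.sum_prod_type]
  rfl

end Trajectory

/-! ### Inequalities for `x log x`. -/

section Scalar

open Real

/-- On `[0,1]` the function `z log z` is 1-strongly convex: `z log z - z²/2` has second derivative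
`1/z - 1 ≥ 0`, so it lies above its tangent at `y`. -/
theorem half_sq_sub_le_bregman {x y : ℝ} (hx0 : 0 ≤ x) (hx1 : x ≤ 1) (hy0 : 0 < y) (hy1 : y ≤ 1) :
    (x - y) ^ 2 / 2 ≤ x * (log x - log y) - (x - y) := by
  rcases hx0.eq_or_lt with rfl | hx
  · nlinarith
  let f : ℝ → ℝ := fun z => z * log z - z ^ 2 / 2
  have hder : ∀ z : ℝ, 0 < z → HasDerivAt f (log z + 1 - z) z := fun z hz => by
    have h1 := (hasDerivAt_mul_log hz.ne').sub (((hasDerivAt_id z).pow 2).div_const 2)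
    refine h1.congr_deriv ?_
    simp
  have hf : ConvexOn ℝ (Icc (0 : ℝ) 1) f := by
    refine convexOn_of_deriv2_nonneg (convex_Icc _ _)
      (by have := continuous_mul_log; unfold f; fun_prop) ?_ ?_ ?_
    · intro z hz
      rw [interior_Icc] at hz
      exact (hder z hz.1).differentiableAt.differentiableWithinAt
    · intro z hz
      rw [interior_Icc] at hz
      have he : deriv f =ᶠ[𝓝 z] fun z => log z + 1 - z := by
        filter_upwards [isOpen_Ioo.mem_nhds hz] with w hw using (hder w hw.1).deriv
      refine (he.differentiableAt_iff.2 ?_).differentiableWithinAt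
      have := hz.1.ne'
      fun_prop (disch := assumption)
    · intro z hz
      rw [interior_Icc] at hz
      have he : deriv f =ᶠ[𝓝 z] fun z => log z + 1 - z := by
        filter_upwards [isOpen_Ioo.mem_nhds hz] with w hw using (hder w hw.1).deriv
      have h2 : HasDerivAt (fun z => log z + 1 - z) (z⁻¹ - 1) z :=
        ((hasDerivAt_log hz.1.ne').add_const 1).sub (hasDerivAt_id z)
      have : deriv^[2] f z = z⁻¹ - 1 := by
        simp only [Function.iterate_succ, Function.iterate_zero, Function.comp, id]
        rw [he.deriv_eq, h2.deriv]
      rw [this, sub_nonneg]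
      exact (one_le_inv₀ hz.1).2 hz.2.le
  have key : f y + (log y + 1 - y) * (x - y) ≤ f x := by
    rcases lt_trichotomy x y with h | h | h
    · have := hf.slope_le_of_hasDerivAt ⟨hx0, hx1⟩ ⟨hy0.le, hy1⟩ h (hder y hy0)
      rw [slope_def_field, div_le_iff₀ (sub_pos.2 h)] at this
      linarith
    · simp [h]
    · have := hf.le_slope_of_hasDerivAt ⟨hy0.le, hy1⟩ ⟨hx0, hx1⟩ h (hder y hy0)
      rw [slope_def_field, le_div_iff₀ (sub_pos.2 h)] at this
      linarith
  unfold f at key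
  nlinarith

/-- This is `log z ≤ z - 1` at `z = x/y`. It makes the entropy remainder quadratic at positive
policies, which gives differentiability there. -/
theorem bregman_le_sq_div {x y : ℝ} (hx0 : 0 ≤ x) (hy0 : 0 < y) :
    x * (log x - log y) - (x - y) ≤ (x - y) ^ 2 / y := by
  rcases hx0.eq_or_lt with rfl | hx
  · simp [sq, hy0.ne']
  have h := log_le_sub_one_of_pos (div_pos hx hy0)
  rw [log_div hx.ne' hy0.ne'] at h
  have h2 := mul_le_mul_of_nonneg_left h hx.le
  have : (x - y) ^ 2 / y = x * (x / y - 1) - (x - y) := by field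
  linarith

theorem sum_negMulLog_le_log_card {A : Type*} [Fintype A] {q : A → ℝ} (h0 : ∀ a, 0 ≤ q a)
    (h1 : ∑ a, q a = 1) : ∑ a, negMulLog (q a) ≤ log (Fintype.card A) := by
  have hA : Nonempty A := by
    by_contra h
    rw [not_nonempty_iff] at h
    simp at h1
  have hc : (0 : ℝ) < Fintype.card A := by exact_mod_cast Fintype.card_pos
  -- Gibbs' inequality termwise, from `log z ≤ z - 1` at `z = 1/(q a |A|)`; the corrections sum to
  -- zero.
  have h (a : A) : negMulLog (q a) ≤ q a * log (Fintype.card A) + (1 / Fintype.card A - q a) := by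
    rw [negMulLog]
    rcases (h0 a).eq_or_lt with h | h
    · rw [← h]; simp
    have h3 := log_le_sub_one_of_pos (show 0 < 1 / (q a * Fintype.card A) by positivity)
    rw [log_div one_ne_zero (by positivity), log_one, log_mul h.ne' hc.ne'] at h3
    have h4 := mul_le_mul_of_nonneg_left h3 h.le
    have : q a * (1 / (q a * Fintype.card A) - 1) = 1 / Fintype.card A - q a := by
      field_simp
    linarith
  calc _ ≤ ∑ a, (q a * log (Fintype.card A) + (1 / Fintype.card A - q a)) :=
        Finset.sum_le_sum fun a _ => h a
    _ = _ := by
      rw [Finset.sum_add_distrib, Finset.sum_sub_distrib, ← Finset.sum_mul, h1]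
      simp [hc.ne']

end Scalar

/-! ### Gradients relative to a convex set. -/

section Smooth

variable {E : Type*} [NormedAddCommGroup E] [InnerProductSpace ℝ E] [CompleteSpace E]
  {f : E → ℝ} {K : Set E}

theorem HasGradientWithinAt.hasDerivWithinAt_line {g x y : E} (hK : Convex ℝ K)
    (hx : x ∈ K) (hy : y ∈ K) {t : ℝ}
    (hf : HasGradientWithinAt f g K (x + t • (y - x))) :
    HasDerivWithinAt (fun t : ℝ => f (x + t • (y - x))) (inner ℝ g (y - x)) (Icc 0 1) t := by
  have h1 : HasDerivWithinAt (fun t : ℝ => x + t • (y - x)) (y - x) (Icc 0 1) t := by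
    have := (((hasDerivAt_id t).smul_const (y - x)).const_add x).hasDerivWithinAt (s := Icc 0 1)
    simpa using this
  have h2 := (hasGradientWithinAt_iff_hasFDerivWithinAt.1 hf).comp_hasDerivWithinAt t h1
    (fun u hu => hK.add_smul_sub_mem hx hy hu)
  exact h2.congr_deriv (by simp)

/-- A relative gradient is determined only through its pairings with feasible directions; recovering
these as limits of slopes allows two gradients to be compared. -/
theorem HasGradientWithinAt.tendsto_slope {g x y : E} (hK : Convex ℝ K)
    (hx : x ∈ K) (hy : y ∈ K) (hf : HasGradientWithinAt f g K x) :
    Tendsto (fun t : ℝ => (f (x + t • (y - x)) - f x) / t) (𝓝[>] 0) (𝓝 (inner ℝ g (y - x))) := by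
  have h := HasGradientWithinAt.hasDerivWithinAt_line (t := 0) hK hx hy (by simpa using hf)
  rw [hasDerivWithinAt_iff_tendsto_slope] at h
  have h2 := h.mono_left (nhdsWithin_mono (0 : ℝ)
    (show Ioc (0 : ℝ) 1 ⊆ Icc 0 1 \ {0} from fun z hz => ⟨⟨hz.1.le, hz.2⟩, hz.1.ne'⟩))
  rw [nhdsWithin_Ioc_eq_nhdsGT zero_lt_one] at h2
  refine h2.congr fun t => ?_
  simp [slope_def_field]

/-- The bound passes to the limit of slopes. It concerns pairings with feasible directions only,
since the norm of `g` is not controlled when `K` has empty interior. -/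
theorem HasGradientWithinAt.abs_inner_le {g x y : E} (hK : Convex ℝ K)
    (hx : x ∈ K) (hy : y ∈ K) (hf : HasGradientWithinAt f g K x) {ε : ℝ}
    (hε : ∀ z ∈ K, |f z - f x| ≤ ε * ‖z - x‖) : |inner ℝ g (y - x)| ≤ ε * ‖y - x‖ := by
  refine le_of_tendsto (hf.tendsto_slope hK hx hy).abs ?_
  have : Ioc (0 : ℝ) 1 ∈ 𝓝[>] (0 : ℝ) := Ioc_mem_nhdsGT zero_lt_one
  filter_upwards [this] with t ht
  have h := hε _ (hK.add_smul_sub_mem hx hy ⟨ht.1.le, ht.2⟩)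
  rw [add_sub_cancel_left, norm_smul, Real.norm_of_nonneg ht.1.le] at h
  rw [abs_div, abs_of_pos ht.1, div_le_iff₀ ht.1]
  linarith

/-- Along the segment the remainder has derivative at most `L t ‖y - x‖²`, and the mean value
inequality compares it with `L ‖y - x‖² t²/2`. -/
theorem LipschitzSmoothOn.exists_quadratic_bound {L : ℝ} (hf : LipschitzSmoothOn f K L)
    (hK : Convex ℝ K) {x : E} (hx : x ∈ K) : ∃ g, HasGradientWithinAt f g K x ∧
      ∀ y ∈ K, |f y - f x - inner ℝ g (y - x)| ≤ L / 2 * ‖y - x‖ ^ 2 := by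
  obtain ⟨G, hG, hL⟩ := hf
  refine ⟨G x, hG x hx, fun y hy => ?_⟩
  have hd : ∀ t ∈ Icc (0 : ℝ) 1, HasDerivWithinAt (fun t : ℝ => f (x + t • (y - x)) - f x
      - t * inner ℝ (G x) (y - x)) (inner ℝ (G (x + t • (y - x))) (y - x)
      - inner ℝ (G x) (y - x)) (Icc 0 1) t := fun t ht => by
    have h1 := HasGradientWithinAt.hasDerivWithinAt_line hK hx hy
      (hG _ (hK.add_smul_sub_mem hx hy ht))
    have h2 := ((hasDerivAt_id t).mul_const (inner ℝ (G x) (y - x))).hasDerivWithinAt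
      (s := Icc 0 1)
    exact ((h1.sub_const (f x)).sub h2).congr_deriv (by simp)
  have hb := image_norm_le_of_norm_deriv_right_le_deriv_boundary
    (f := fun t : ℝ => f (x + t • (y - x)) - f x - t * inner ℝ (G x) (y - x)) (a := 0) (b := 1)
    (f' := fun t => inner ℝ (G (x + t • (y - x))) (y - x) - inner ℝ (G x) (y - x))
    (B := fun t => L * ‖y - x‖ ^ 2 * (t ^ 2 / 2)) (B' := fun t => L * ‖y - x‖ ^ 2 * t)
    (fun t ht => (hd t ht).continuousWithinAt)
    (fun t ht => (hd t ⟨ht.1, ht.2.le⟩).mono_of_mem_nhdsWithin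
      (Icc_mem_nhdsGE_of_mem ht)) (by simp) (fun t => by
      have := (((hasDerivAt_id t).pow 2).div_const 2).const_mul (L * ‖y - x‖ ^ 2)
      refine this.congr_deriv ?_
      simp) (fun t ht => by
      rw [← inner_sub_left]
      refine (norm_inner_le_norm _ _).trans ?_
      have h := hL x hx _ (hK.add_smul_sub_mem hx hy ⟨ht.1, ht.2.le⟩)
      rw [add_sub_cancel_left, norm_smul, Real.norm_of_nonneg ht.1] at h
      have := mul_le_mul_of_nonneg_right h (norm_nonneg (y - x))
      linarith) (show (1 : ℝ) ∈ Icc 0 1 by simp)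
  simp at hb
  linarith

theorem hasGradientWithinAt_of_quadratic_bound {g x : E} {C : ℝ}
    (h : ∀ y ∈ K, |f y - f x - inner ℝ g (y - x)| ≤ C * ‖y - x‖ ^ 2) :
    HasGradientWithinAt f g K x := by
  rw [hasGradientWithinAt_iff_isLittleO]
  have h1 : (fun y => f y - f x - inner ℝ g (y - x)) =O[𝓝[K] x] fun y => ‖y - x‖ ^ 2 := by
    refine Asymptotics.IsBigO.of_bound C ?_
    filter_upwards [self_mem_nhdsWithin] with y hy
    simpa using h y hy
  refine h1.trans_isLittleO ?_
  have h2 : Tendsto (fun y => y - x) (𝓝[K] x) (𝓝 0) := by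
    have : Tendsto (fun y => y - x) (𝓝 x) (𝓝 (x - x)) := by
      exact (continuous_id.sub continuous_const).tendsto x
    rw [sub_self] at this
    exact this.mono_left nhdsWithin_le_nhds
  exact (Asymptotics.isLittleO_norm_pow_id one_lt_two).comp_tendsto h2

end Smooth

/-! ### The policy space and the regularized Bellman equation. -/

section Bellman

variable {S A : Type*} [Fintype S] [Fintype A]
  {π : SAVec S A} {p : KernelVec S A} {r : SAVec S A} {γ lam : ℝ}

theorem policySpace_le_one (hπ : π ∈ policySpace S A) (x : S × A) : π x ≤ 1 := by
  rw [← hπ.2 x.1]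
  exact Finset.single_le_sum (f := fun a => π (x.1, a)) (fun a _ => hπ.1 _) (Finset.mem_univ x.2)

theorem convex_policySpace : Convex ℝ (policySpace S A) := by
  intro x hx y hy a b ha hb hab
  refine ⟨fun z => ?_, fun s => ?_⟩
  · have := hx.1 z
    have := hy.1 z
    simp only [PiLp.add_apply, PiLp.smul_apply, smul_eq_mul]
    positivity
  · simp only [PiLp.add_apply, PiLp.smul_apply, smul_eq_mul, Finset.sum_add_distrib,
      ← Finset.mul_sum, hx.2, hy.2, mul_one, hab]

theorem isCompact_policySpace : IsCompact (policySpace S A) := by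
  refine Metric.isCompact_of_isClosed_isBounded ?_ ?_
  · refine IsClosed.inter (s₁ := {π : SAVec S A | ∀ x, 0 ≤ π x})
      (s₂ := {π : SAVec S A | ∀ s, ∑ a, π (s, a) = 1}) ?_ ?_
    · simp only [ofPred_forall]
      exact isClosed_iInter fun x => isClosed_le continuous_const (by fun_prop)
    · simp only [ofPred_forall]
      exact isClosed_iInter fun x => isClosed_eq (by fun_prop) continuous_const
  · refine isBounded_iff_forall_norm_le.2 ⟨√(∑ _x : S × A, (1 : ℝ) ^ 2), fun π hπ => ?_⟩
    rw [EuclideanSpace.norm_eq]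
    refine Real.sqrt_le_sqrt (Finset.sum_le_sum fun x _ => ?_)
    rw [Real.norm_of_nonneg (hπ.1 x)]
    exact pow_le_pow_left₀ (hπ.1 x) (policySpace_le_one hπ x) 2

/-- `V` solves the regularized Bellman equation of policy `π` in the environment `(p, r)`. -/
def IsBellmanSolution (γ lam : ℝ) (π : SAVec S A) (p : KernelVec S A) (r : SAVec S A)
    (V : S → ℝ) : Prop :=
  ∀ s, V s = ∑ a, π (s, a) * (r (s, a) - lam * Real.log (π (s, a))
    + γ * ∑ s', p (s, a, s') * V s')

/-- The Bellman operator is a `γ`-contraction in the sup norm. -/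
theorem exists_isBellmanSolution (hγ0 : 0 < γ) (hγ1 : γ < 1)
    (hπ : π ∈ policySpace S A) (hp : p ∈ kernelSpace S A) (r : SAVec S A) (lam : ℝ) :
    ∃ V, IsBellmanSolution γ lam π p r V := by
  let T : (S → ℝ) → S → ℝ := fun V s => ∑ a, π (s, a) * (r (s, a) - lam * Real.log (π (s, a))
    + γ * ∑ s', p (s, a, s') * V s')
  have hT : ContractingWith ⟨γ, hγ0.le⟩ T := by
    refine ⟨by exact_mod_cast hγ1, LipschitzWith.of_dist_le_mul fun V W => ?_⟩
    refine (dist_pi_le_iff (by positivity)).2 fun s => ?_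
    have h1 : T V s - T W s = γ * ∑ a, π (s, a) * ∑ s', p (s, a, s') * (V s' - W s') := by
      simp only [T]
      rw [← Finset.sum_sub_distrib, Finset.mul_sum]
      refine Finset.sum_congr rfl fun a _ => ?_
      simp only [mul_sub, Finset.sum_sub_distrib]
      ring
    rw [Real.dist_eq, h1, abs_mul, abs_of_pos hγ0]
    refine mul_le_mul_of_nonneg_left ?_ hγ0.le
    calc _ ≤ ∑ a, π (s, a) * ∑ s', p (s, a, s') * dist V W := by
          refine (Finset.abs_sum_le_sum_abs _ _).trans (Finset.sum_le_sum fun a _ => ?_)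
          rw [abs_mul, abs_of_nonneg (hπ.1 _)]
          refine mul_le_mul_of_nonneg_left ?_ (hπ.1 _)
          refine (Finset.abs_sum_le_sum_abs _ _).trans (Finset.sum_le_sum fun s' _ => ?_)
          rw [abs_mul, abs_of_nonneg (hp.1 _)]
          exact mul_le_mul_of_nonneg_left (dist_le_pi_dist V W s') (hp.1 _)
      _ = dist V W := by
          simp only [← Finset.sum_mul, hp.2, one_mul, hπ.2]
  exact ⟨hT.fixedPoint T, fun s => (congrFun hT.fixedPoint_isFixedPt s).symm⟩

/-- Maximum principle: at a state where `V` is extremal, the averaged continuation value is bounded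
by `V` itself, so `(1 - γ) V` is controlled by reward plus entropy. -/
theorem IsBellmanSolution.bounds (hγ0 : 0 < γ) (hγ1 : γ < 1) (hlam : 0 ≤ lam)
    (hπ : π ∈ policySpace S A) (hp : p ∈ kernelSpace S A) (hr : r ∈ rewardSpace S A)
    {V : S → ℝ} (hV : IsBellmanSolution γ lam π p r V) (s : S) :
    0 ≤ V s ∧ V s ≤ (1 + lam * Real.log (Fintype.card A)) / (1 - γ) := by
  have : Nonempty S := ⟨s⟩
  have hd (s : S) : V s = ∑ a, π (s, a) * r (s, a) + lam * ∑ a, Real.negMulLog (π (s, a))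
      + γ * ∑ a, π (s, a) * ∑ s', p (s, a, s') * V s' := by
    rw [hV s, Finset.mul_sum, Finset.mul_sum, ← Finset.sum_add_distrib, ← Finset.sum_add_distrib]
    refine Finset.sum_congr rfl fun a _ => ?_
    rw [Real.negMulLog]; ring
  constructor
  · obtain ⟨t, ht⟩ := Finite.exists_min V
    refine le_trans ?_ (ht s)
    have h1 : 0 ≤ ∑ a, π (t, a) * r (t, a) :=
      Finset.sum_nonneg fun a _ => mul_nonneg (hπ.1 _) (hr _).1
    have h2 : 0 ≤ lam * ∑ a, Real.negMulLog (π (t, a)) :=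
      mul_nonneg hlam (Finset.sum_nonneg fun a _ =>
        Real.negMulLog_nonneg (hπ.1 _) (policySpace_le_one hπ _))
    have h3 : V t ≤ ∑ a, π (t, a) * ∑ s', p (t, a, s') * V s' := by
      calc V t = ∑ a, π (t, a) * ∑ s', p (t, a, s') * V t := by
            simp only [← Finset.sum_mul, hp.2, one_mul, hπ.2]
        _ ≤ _ := Finset.sum_le_sum fun a _ => mul_le_mul_of_nonneg_left
            (Finset.sum_le_sum fun s' _ => mul_le_mul_of_nonneg_left (ht s') (hp.1 _)) (hπ.1 _)
    have := hd t
    nlinarith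
  · obtain ⟨t, ht⟩ := Finite.exists_max V
    refine (ht s).trans ?_
    have h1 : ∑ a, π (t, a) * r (t, a) ≤ 1 := by
      rw [← hπ.2 t]
      exact Finset.sum_le_sum fun a _ => mul_le_of_le_one_right (hπ.1 _) (hr _).2
    have h2 : lam * ∑ a, Real.negMulLog (π (t, a)) ≤ lam * Real.log (Fintype.card A) :=
      mul_le_mul_of_nonneg_left (sum_negMulLog_le_log_card (fun a => hπ.1 _) (hπ.2 t)) hlam
    have h3 : ∑ a, π (t, a) * ∑ s', p (t, a, s') * V s' ≤ V t := by
      calc _ ≤ ∑ a, π (t, a) * ∑ s', p (t, a, s') * V t :=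
            Finset.sum_le_sum fun a _ => mul_le_mul_of_nonneg_left
              (Finset.sum_le_sum fun s' _ => mul_le_mul_of_nonneg_left (ht s') (hp.1 _)) (hπ.1 _)
        _ = _ := by
            simp only [← Finset.sum_mul, hp.2, one_mul, hπ.2]
    have := hd t
    rw [le_div_iff₀ (by linarith)]
    nlinarith

end Bellman

/-! ### The performance difference formula. -/

section PerformanceDifference

variable {S A : Type*} [Fintype S] [Fintype A]
  [MeasurableSpace S] [DiscreteMeasurableSpace S]
  [MeasurableSpace A] [DiscreteMeasurableSpace A]
  {ρ : S → ℝ} {γ lam : ℝ}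

/-- Pairing the state flow equation with `V` shows that adding the potential `V` telescopes. No
equation for `V` is needed; the bracket is its Bellman residual. -/
theorem entropyValue_eq_potential (lam : ℝ) (hγ0 : 0 < γ) (hγ1 : γ < 1) (hρ : ρ ∈ stdSimplex ℝ S)
    {π : SAVec S A} {p : KernelVec S A} (r : SAVec S A)
    (hπ : π ∈ policySpace S A) (hp : p ∈ kernelSpace S A) (V : S → ℝ) :
    (1 - γ) * entropyValue γ lam ρ π p r = (1 - γ) * ∑ s, ρ s * V s
      + ∑ s, stateOccupancy γ ρ π p s * (∑ a, π (s, a) * (r (s, a) - lam * Real.log (π (s, a))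
        + γ * ∑ s', p (s, a, s') * V s') - V s) := by
  have h1 : ∑ s, stateOccupancy γ ρ π p s * V s = (1 - γ) * ∑ s, ρ s * V s
      + γ * ∑ x : S × A, occupancy γ ρ π p x * ∑ s, p (x.1, x.2, s) * V s := by
    simp only [stateOccupancy_flow hγ0 hγ1 hρ hπ hp, add_mul, Finset.sum_add_distrib, mul_assoc,
      ← Finset.mul_sum]
    congr 2
    simp only [Finset.mul_sum, Finset.sum_mul]
    rw [Finset.sum_comm]
    simp only [mul_assoc]
  have h2 : ∑ s, stateOccupancy γ ρ π p s * (∑ a, π (s, a) * (r (s, a)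
        - lam * Real.log (π (s, a)) + γ * ∑ s', p (s, a, s') * V s')) =
      ∑ x : S × A, occupancy γ ρ π p x * (r x - lam * Real.log (π x)
        + γ * ∑ s', p (x.1, x.2, s') * V s') := by
    rw [Fintype.sum_prod_type]
    refine Finset.sum_congr rfl fun s _ => ?_
    rw [Finset.mul_sum]
    refine Finset.sum_congr rfl fun a _ => ?_
    rw [occupancy_eq hγ0 hγ1 hρ hπ hp, mul_assoc]
  simp only [mul_sub (stateOccupancy _ _ _ _ _), Finset.sum_sub_distrib, h1, h2]
  rw [entropyValue_eq lam hγ0 hγ1 hρ hπ hp]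
  simp only [mul_add (occupancy _ _ _ _ _), Finset.sum_add_distrib, Finset.mul_sum]
  have : ∀ x : S × A, ∀ s', occupancy γ ρ π p x * (γ * (p (x.1, x.2, s') * V s')) =
    γ * (occupancy γ ρ π p x * (p (x.1, x.2, s') * V s')) := fun x s' => by ring
  simp only [this]
  ring

/-- The one-step return `r(s,a) + γ ∑_{s'} p(s'|s,a) V(s')`. -/
def oneStepReturn (γ : ℝ) (p : KernelVec S A) (r : SAVec S A) (V : S → ℝ) (x : S × A) : ℝ :=
  r x + γ * ∑ s', p (x.1, x.2, s') * V s'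

/-- Use the Bellman solution of the old policy as potential for both policies: the old residual
vanishes and the initial terms cancel. -/
theorem entropyValue_sub (hγ0 : 0 < γ) (hγ1 : γ < 1) (hρ : ρ ∈ stdSimplex ℝ S)
    {π₀ π : SAVec S A} {p₀ p : KernelVec S A} {r₀ : SAVec S A} (r : SAVec S A)
    (hπ₀ : π₀ ∈ policySpace S A) (hp₀ : p₀ ∈ kernelSpace S A)
    (hπ : π ∈ policySpace S A) (hp : p ∈ kernelSpace S A) {V : S → ℝ}
    (hV : IsBellmanSolution γ lam π₀ p₀ r₀ V) :
    (1 - γ) * (entropyValue γ lam ρ π p r - entropyValue γ lam ρ π₀ p₀ r₀) =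
      ∑ s, stateOccupancy γ ρ π p s * ∑ a, ((π (s, a) - π₀ (s, a)) * oneStepReturn γ p₀ r₀ V (s, a)
        + lam * (Real.negMulLog (π (s, a)) - Real.negMulLog (π₀ (s, a))))
      + ∑ x, occupancy γ ρ π p x * (oneStepReturn γ p r V x - oneStepReturn γ p₀ r₀ V x) := by
  have h0 := entropyValue_eq_potential lam hγ0 hγ1 hρ r₀ hπ₀ hp₀ V
  simp only [← hV _, sub_self, mul_zero, Finset.sum_const_zero, add_zero] at h0
  rw [mul_sub, h0, entropyValue_eq_potential lam hγ0 hγ1 hρ r hπ hp V, add_sub_cancel_left,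
    Fintype.sum_prod_type, ← Finset.sum_add_distrib]
  refine Finset.sum_congr rfl fun s _ => ?_
  simp only [occupancy_eq hγ0 hγ1 hρ hπ hp, mul_assoc]
  rw [← Finset.mul_sum, ← mul_add, ← Finset.sum_add_distrib]
  congr 1
  rw [hV s]
  rw [← Finset.sum_sub_distrib]
  refine Finset.sum_congr rfl fun a _ => ?_
  simp only [oneStepReturn, Real.negMulLog]
  ring

end PerformanceDifference

/-! ### Lipschitz dependence of occupancies on policy and kernel. -/

theorem sum_abs_comp_le_sqrt_card_mul_norm {ι κ : Type*} [Fintype ι] [Fintype κ]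
    (v : EuclideanSpace ℝ ι) {f : κ → ι} (hf : Function.Injective f) :
    ∑ k, |v (f k)| ≤ √(Fintype.card κ) * ‖v‖ := by
  refine (abs_le_of_sq_le_sq' ?_ (by positivity)).2
  rw [mul_pow, Real.sq_sqrt (by positivity), EuclideanSpace.norm_sq_eq]
  refine sq_sum_le_card_mul_sum_sq.trans ?_
  rw [Finset.card_univ]
  refine mul_le_mul_of_nonneg_left ?_ (by positivity)
  simp only [Real.norm_eq_abs, sq_abs]
  classical
  calc ∑ k, v (f k) ^ 2 = ∑ i ∈ Finset.univ.image f, v i ^ 2 := by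
        rw [Finset.sum_image fun a _ b _ h => hf h]
    _ ≤ _ := Finset.sum_le_sum_of_subset_of_nonneg (Finset.subset_univ _)
        fun i _ _ => sq_nonneg _

theorem abs_apply_le_norm {ι : Type*} [Fintype ι] (v : EuclideanSpace ℝ ι) (i : ι) :
    |v i| ≤ ‖v‖ := PiLp.norm_apply_le v i

section OccupancyLipschitz

variable {S A : Type*} [Fintype S] [Fintype A]
  [MeasurableSpace S] [DiscreteMeasurableSpace S]
  [MeasurableSpace A] [DiscreteMeasurableSpace A]
  {ρ : S → ℝ} {γ : ℝ} {π₀ π : SAVec S A} {p₀ p : KernelVec S A}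

theorem stateOccupancy_nonneg (hγ0 : 0 < γ) (hγ1 : γ < 1) (s : S) :
    0 ≤ stateOccupancy γ ρ π p s :=
  Finset.sum_nonneg fun _ _ => occupancy_nonneg hγ0 hγ1 _

theorem stateOccupancy_le_one (hγ0 : 0 < γ) (hγ1 : γ < 1) (hρ : ρ ∈ stdSimplex ℝ S)
    (hπ : π ∈ policySpace S A) (hp : p ∈ kernelSpace S A) (s : S) :
    stateOccupancy γ ρ π p s ≤ 1 := by
  rw [← sum_stateOccupancy hγ0 hγ1 hρ hπ hp]
  exact Finset.single_le_sum (fun s _ => stateOccupancy_nonneg hγ0 hγ1 s) (Finset.mem_univ s)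

/-- Product rule for `d(s) π(a|s)`. Cauchy–Schwarz is applied within each row and the rows are
averaged by `d`, so only `√|A|` appears. -/
theorem sum_abs_occupancy_sub_le (hγ0 : 0 < γ) (hγ1 : γ < 1) (hρ : ρ ∈ stdSimplex ℝ S)
    (hπ₀ : π₀ ∈ policySpace S A) (hp₀ : p₀ ∈ kernelSpace S A)
    (hπ : π ∈ policySpace S A) (hp : p ∈ kernelSpace S A) :
    ∑ x, |occupancy γ ρ π p x - occupancy γ ρ π₀ p₀ x| ≤ √(Fintype.card A) * ‖π - π₀‖
      + ∑ s, |stateOccupancy γ ρ π p s - stateOccupancy γ ρ π₀ p₀ s| := by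
  have h (x : S × A) : |occupancy γ ρ π p x - occupancy γ ρ π₀ p₀ x| ≤
      stateOccupancy γ ρ π p x.1 * |(π - π₀) x|
      + |stateOccupancy γ ρ π p x.1 - stateOccupancy γ ρ π₀ p₀ x.1| * π₀ x := by
    rw [occupancy_eq hγ0 hγ1 hρ hπ hp, occupancy_eq hγ0 hγ1 hρ hπ₀ hp₀]
    have e : stateOccupancy γ ρ π p x.1 * π x - stateOccupancy γ ρ π₀ p₀ x.1 * π₀ x =
      stateOccupancy γ ρ π p x.1 * (π - π₀) x
      + (stateOccupancy γ ρ π p x.1 - stateOccupancy γ ρ π₀ p₀ x.1) * π₀ x := by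
      rw [PiLp.sub_apply]; ring
    rw [e]
    refine (abs_add_le _ _).trans ?_
    rw [abs_mul, abs_mul, abs_of_nonneg (stateOccupancy_nonneg hγ0 hγ1 _),
      abs_of_nonneg (hπ₀.1 x)]
  refine (Finset.sum_le_sum fun x _ => h x).trans ?_
  rw [Finset.sum_add_distrib, Fintype.sum_prod_type, Fintype.sum_prod_type]
  simp only [← Finset.mul_sum, hπ₀.2, mul_one]
  gcongr
  calc _ ≤ ∑ s, stateOccupancy γ ρ π p s * (√(Fintype.card A) * ‖π - π₀‖) := by
        refine Finset.sum_le_sum fun s _ => mul_le_mul_of_nonneg_left ?_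
          (stateOccupancy_nonneg hγ0 hγ1 _)
        exact sum_abs_comp_le_sqrt_card_mul_norm (π - π₀) (Prod.mk_right_injective s)
    _ = _ := by rw [← Finset.sum_mul, sum_stateOccupancy hγ0 hγ1 hρ hπ hp, one_mul]

/-- Subtracting the flow equations bounds the difference by `γ` times itself plus perturbations;
absorbing it leaves the factor `1 - γ`. -/
theorem sum_abs_stateOccupancy_sub_le (hγ0 : 0 < γ) (hγ1 : γ < 1) (hρ : ρ ∈ stdSimplex ℝ S)
    (hπ₀ : π₀ ∈ policySpace S A) (hp₀ : p₀ ∈ kernelSpace S A)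
    (hπ : π ∈ policySpace S A) (hp : p ∈ kernelSpace S A) :
    (1 - γ) * ∑ s, |stateOccupancy γ ρ π p s - stateOccupancy γ ρ π₀ p₀ s| ≤
      γ * (√(Fintype.card A) * ‖π - π₀‖ + √(Fintype.card S) * ‖p - p₀‖) := by
  have h (s : S) : |stateOccupancy γ ρ π p s - stateOccupancy γ ρ π₀ p₀ s| ≤
      γ * ∑ x : S × A, (occupancy γ ρ π p x * |(p - p₀) (x.1, x.2, s)|
        + |occupancy γ ρ π p x - occupancy γ ρ π₀ p₀ x| * p₀ (x.1, x.2, s)) := by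
    rw [stateOccupancy_flow hγ0 hγ1 hρ hπ hp, stateOccupancy_flow hγ0 hγ1 hρ hπ₀ hp₀,
      add_sub_add_left_eq_sub, ← mul_sub, ← Finset.sum_sub_distrib, abs_mul, abs_of_pos hγ0]
    refine mul_le_mul_of_nonneg_left ((Finset.abs_sum_le_sum_abs _ _).trans
      (Finset.sum_le_sum fun x _ => ?_)) hγ0.le
    have e : occupancy γ ρ π p x * p (x.1, x.2, s) - occupancy γ ρ π₀ p₀ x * p₀ (x.1, x.2, s) =
      occupancy γ ρ π p x * (p - p₀) (x.1, x.2, s)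
      + (occupancy γ ρ π p x - occupancy γ ρ π₀ p₀ x) * p₀ (x.1, x.2, s) := by
      rw [PiLp.sub_apply]; ring
    rw [e]
    refine (abs_add_le _ _).trans ?_
    rw [abs_mul, abs_mul, abs_of_nonneg (occupancy_nonneg hγ0 hγ1 _), abs_of_nonneg (hp₀.1 _)]
  have h2 : ∑ s, |stateOccupancy γ ρ π p s - stateOccupancy γ ρ π₀ p₀ s| ≤
      γ * (√(Fintype.card S) * ‖p - p₀‖
        + ∑ x, |occupancy γ ρ π p x - occupancy γ ρ π₀ p₀ x|) := by
    refine (Finset.sum_le_sum fun s _ => h s).trans ?_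
    rw [← Finset.mul_sum, Finset.sum_comm]
    refine mul_le_mul_of_nonneg_left ?_ hγ0.le
    simp only [Finset.sum_add_distrib, ← Finset.mul_sum, hp₀.2, mul_one]
    gcongr
    calc _ ≤ ∑ x : S × A, occupancy γ ρ π p x * (√(Fintype.card S) * ‖p - p₀‖) := by
          refine Finset.sum_le_sum fun x _ => mul_le_mul_of_nonneg_left ?_
            (occupancy_nonneg hγ0 hγ1 _)
          exact sum_abs_comp_le_sqrt_card_mul_norm (p - p₀) (f := fun s' => (x.1, x.2, s'))
            fun a b hab => by simpa using hab
      _ = _ := by rw [← Finset.sum_mul, sum_occupancy hγ0 hγ1 hρ hπ hp, one_mul]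
  have h3 := sum_abs_occupancy_sub_le hγ0 hγ1 hρ hπ₀ hp₀ hπ hp
  nlinarith

end OccupancyLipschitz

/-! ### Linearization of the environment and independent mixing of policy rows. -/

section Environment

variable {S A : Type*} [Fintype S] [Fintype A]

/-- With `V` frozen, the one-step return is linear in `(p, r)`, so one vector `G` inherits the
quadratic remainder from smoothness and the first-order bound from sensitivity. The factor `|S| M`
comes from the sum over next states. -/
theorem exists_gradient_oneStepReturn {γ : ℝ} (hγ0 : 0 < γ)
    {p : SAVec S A → KernelVec S A} {r : SAVec S A → SAVec S A} {εp εr Sp Sr M : ℝ}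
    (hsens_p : ∀ π ∈ policySpace S A, ∀ π' ∈ policySpace S A, ‖p π' - p π‖ ≤ εp * ‖π' - π‖)
    (hsens_r : ∀ π ∈ policySpace S A, ∀ π' ∈ policySpace S A, ‖r π' - r π‖ ≤ εr * ‖π' - π‖)
    (hsmooth_p : ∀ s a s', LipschitzSmoothOn (fun π => p π (s, a, s')) (policySpace S A) Sp)
    (hsmooth_r : ∀ s a, LipschitzSmoothOn (fun π => r π (s, a)) (policySpace S A) Sr)
    {V : S → ℝ} (hV : ∀ s, |V s| ≤ M) {π₀ : SAVec S A} (hπ₀ : π₀ ∈ policySpace S A) (x : S × A) :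
    ∃ G : SAVec S A, ∀ π ∈ policySpace S A,
      |oneStepReturn γ (p π) (r π) V x - oneStepReturn γ (p π₀) (r π₀) V x
        - inner ℝ G (π - π₀)| ≤ (Sr + γ * Fintype.card S * M * Sp) / 2 * ‖π - π₀‖ ^ 2 ∧
      |inner ℝ G (π - π₀)| ≤ (εr + γ * Fintype.card S * M * εp) * ‖π - π₀‖ := by
  obtain ⟨Gr, hGr, hGr'⟩ := (hsmooth_r x.1 x.2).exists_quadratic_bound convex_policySpace hπ₀
  choose Gp hGp hGp' using fun s' =>
    (hsmooth_p x.1 x.2 s').exists_quadratic_bound convex_policySpace hπ₀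
  have hin (w : SAVec S A) : inner ℝ (Gr + γ • ∑ s', V s' • Gp s') w =
      inner ℝ Gr w + γ * ∑ s', V s' * inner ℝ (Gp s') w := by
    simp only [inner_add_left, real_inner_smul_left, sum_inner]
  have hsum {b : S → ℝ} {B : ℝ} (hb : ∀ s, |b s| ≤ B) :
      |γ * ∑ s', V s' * b s'| ≤ γ * Fintype.card S * M * B := by
    rw [abs_mul, abs_of_pos hγ0, mul_assoc, mul_assoc]
    refine mul_le_mul_of_nonneg_left ?_ hγ0.le
    calc _ ≤ ∑ s' : S, M * B := (Finset.abs_sum_le_sum_abs _ _).trans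
          (Finset.sum_le_sum fun s' _ => by
            rw [abs_mul]
            exact mul_le_mul (hV s') (hb s') (abs_nonneg _) ((abs_nonneg _).trans (hV s')))
      _ = _ := by simp
  refine ⟨Gr + γ • ∑ s', V s' • Gp s', fun π hπ => ⟨?_, ?_⟩⟩
  · have e : oneStepReturn γ (p π) (r π) V x - oneStepReturn γ (p π₀) (r π₀) V x
        - inner ℝ (Gr + γ • ∑ s', V s' • Gp s') (π - π₀) =
        (r π (x.1, x.2) - r π₀ (x.1, x.2) - inner ℝ Gr (π - π₀))
        + γ * ∑ s', V s' * (p π (x.1, x.2, s') - p π₀ (x.1, x.2, s')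
          - inner ℝ (Gp s') (π - π₀)) := by
      rw [hin]
      simp only [oneStepReturn, mul_sub (V _), Finset.sum_sub_distrib, mul_comm (V _) (p _ _)]
      ring
    rw [e]
    refine (abs_add_le _ _).trans ?_
    have h1 := hGr' π hπ
    have h2 := hsum fun s' => hGp' s' π hπ
    linarith
  · rw [hin]
    refine (abs_add_le _ _).trans ?_
    have h1 := hGr.abs_inner_le convex_policySpace hπ₀ hπ (ε := εr) fun z hz =>
      (abs_apply_le_norm (r z - r π₀) (x.1, x.2)).trans (hsens_r _ hπ₀ _ hz)
    have h2 := hsum fun s' =>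
      (hGp s').abs_inner_le convex_policySpace hπ₀ hπ (ε := εp) fun z hz =>
        (abs_apply_le_norm (p z - p π₀) (x.1, x.2, s')).trans (hsens_p _ hπ₀ _ hz)
    linarith

/-- The part of the vector `u` belonging to the state `s`. -/
noncomputable def rowPart (s : S) (u : SAVec S A) : SAVec S A :=
  open Classical in WithLp.toLp 2 fun x => if x.1 = s then u x else 0

omit [Fintype S] [Fintype A] in
theorem rowPart_apply (s : S) (u : SAVec S A) (x : S × A) [Decidable (x.1 = s)] :
    rowPart s u x = if x.1 = s then u x else 0 := by
  simp [rowPart]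

theorem sum_smul_rowPart_apply (c : S → ℝ) (u : SAVec S A) (x : S × A) :
    (∑ s, c s • rowPart s u) x = c x.1 * u x := by
  classical
  simp [rowPart_apply]

theorem norm_rowPart_le (s : S) (u : SAVec S A) : ‖rowPart s u‖ ≤ ‖u‖ := by
  classical
  rw [EuclideanSpace.norm_eq, EuclideanSpace.norm_eq]
  refine Real.sqrt_le_sqrt (Finset.sum_le_sum fun x _ => ?_)
  rw [rowPart_apply]
  split_ifs
  · rfl
  · simpa using sq_nonneg (u x)

theorem add_sum_smul_rowPart_mem_policySpace {π₀ π : SAVec S A} (hπ₀ : π₀ ∈ policySpace S A)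
    (hπ : π ∈ policySpace S A) {c : S → ℝ} (hc : ∀ s, c s ∈ Icc (0 : ℝ) 1) :
    π₀ + ∑ s, c s • rowPart s (π - π₀) ∈ policySpace S A := by
  have h (x : S × A) : (π₀ + ∑ s, c s • rowPart s (π - π₀)) x =
      (1 - c x.1) * π₀ x + c x.1 * π x := by
    rw [PiLp.add_apply, sum_smul_rowPart_apply, PiLp.sub_apply]; ring
  refine ⟨fun x => ?_, fun s => ?_⟩
  · rw [h]
    exact add_nonneg (mul_nonneg (sub_nonneg.2 (hc _).2) (hπ₀.1 _))
      (mul_nonneg (hc _).1 (hπ.1 _))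
  · simp only [h, Finset.sum_add_distrib, ← Finset.mul_sum, hπ₀.2, hπ.2]
    ring

theorem add_rowPart_mem_policySpace {π₀ π : SAVec S A} (hπ₀ : π₀ ∈ policySpace S A)
    (hπ : π ∈ policySpace S A) (s : S) : π₀ + rowPart s (π - π₀) ∈ policySpace S A := by
  classical
  have h := add_sum_smul_rowPart_mem_policySpace hπ₀ hπ (c := Pi.single s 1) fun t => by
    by_cases hst : t = s
    · subst hst; simp
    · simp [hst]
  rw [Finset.sum_eq_single s (fun t _ hts => by simp [hts]) (by simp)] at h
  simpa using h

end Environment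

/-! ### Second-order error of the environment term. -/

section ErrorBounds

variable {S A : Type*} [Fintype S] [Fintype A]

/-- Three errors add up: linearizing `Δ`, replacing `w` by `w₀`, and replacing `u` by its rescaled
rows. The last is split row by row, because `G x` is controlled only along feasible directions and
each row of `u` is one. -/
theorem environment_error_le {π₀ π : SAVec S A} (hπ₀ : π₀ ∈ policySpace S A)
    (hπ : π ∈ policySpace S A) {d₀ d : S → ℝ} {w₀ w Δ : S × A → ℝ} {G : S × A → SAVec S A}
    {D ε q : ℝ} (hD : 0 < D) (hε : 0 ≤ ε) (hd₀ : ∀ s, D ≤ d₀ s)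
    (hw₀ : ∀ x, 0 ≤ w₀ x) (hw₀' : ∑ x, w₀ x = 1) (hw : ∀ x, 0 ≤ w x) (hw' : ∑ x, w x = 1)
    (hΔ : ∀ x, |Δ x - inner ℝ (G x) (π - π₀)| ≤ q)
    (hG : ∀ x, ∀ y ∈ policySpace S A, |inner ℝ (G x) (y - π₀)| ≤ ε * ‖y - π₀‖) :
    ∑ x, w x * Δ x - ∑ x, w₀ x * inner ℝ (G x) (∑ s, (d s / d₀ s) • rowPart s (π - π₀)) ≤
      q + ε * ‖π - π₀‖ * (∑ x, |w x - w₀ x| + D⁻¹ * ∑ s, |d s - d₀ s|) := by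
  set u := π - π₀ with hu
  have hsplit (x : S × A) : inner ℝ (G x) u - inner ℝ (G x) (∑ s, (d s / d₀ s) • rowPart s u)
      = ∑ s, (1 - d s / d₀ s) * inner ℝ (G x) (rowPart s u) := by
    have : u - ∑ s, (d s / d₀ s) • rowPart s u = ∑ s, (1 - d s / d₀ s) • rowPart s u := by
      ext y
      rw [PiLp.sub_apply, sum_smul_rowPart_apply, sum_smul_rowPart_apply]
      ring
    rw [← inner_sub_right, this, inner_sum]
    simp only [real_inner_smul_right]
  have hc (s : S) : |1 - d s / d₀ s| ≤ D⁻¹ * |d s - d₀ s| := by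
    have h0 : 0 < d₀ s := hD.trans_le (hd₀ s)
    rw [show 1 - d s / d₀ s = (d₀ s)⁻¹ * -(d s - d₀ s) by field, abs_mul, abs_neg,
      abs_of_pos (inv_pos.2 h0)]
    exact mul_le_mul_of_nonneg_right (inv_anti₀ hD (hd₀ s)) (abs_nonneg _)
  have hrow (x : S × A) : ∑ s, (1 - d s / d₀ s) * inner ℝ (G x) (rowPart s u)
      ≤ ε * ‖u‖ * (D⁻¹ * ∑ s, |d s - d₀ s|) := by
    rw [Finset.mul_sum, Finset.mul_sum]
    refine Finset.sum_le_sum fun s _ => (le_abs_self _).trans ?_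
    rw [abs_mul, mul_comm]
    refine mul_le_mul ?_ (hc s) (abs_nonneg _) (by positivity)
    have := hG x _ (add_rowPart_mem_policySpace hπ₀ hπ s)
    rw [add_sub_cancel_left] at this
    exact this.trans (mul_le_mul_of_nonneg_left (norm_rowPart_le s u) hε)
  have hterm (x : S × A) :
      w x * Δ x - w₀ x * inner ℝ (G x) (∑ s, (d s / d₀ s) • rowPart s u) ≤
      w x * q + |w x - w₀ x| * (ε * ‖u‖) + w₀ x * (ε * ‖u‖ * (D⁻¹ * ∑ s, |d s - d₀ s|)) := by
    have e : w x * Δ x - w₀ x * inner ℝ (G x) (∑ s, (d s / d₀ s) • rowPart s u) =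
        w x * (Δ x - inner ℝ (G x) u) + (w x - w₀ x) * inner ℝ (G x) u
        + w₀ x * (inner ℝ (G x) u - inner ℝ (G x) (∑ s, (d s / d₀ s) • rowPart s u)) := by ring
    rw [e, hsplit]
    refine add_le_add (add_le_add ?_ ?_) (mul_le_mul_of_nonneg_left (hrow x) (hw₀ x))
    · exact mul_le_mul_of_nonneg_left ((le_abs_self _).trans (hΔ x)) (hw x)
    · refine (le_abs_self _).trans ?_
      rw [abs_mul]
      exact mul_le_mul_of_nonneg_left (hG x π hπ) (abs_nonneg _)
  rw [← Finset.sum_sub_distrib]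
  refine (Finset.sum_le_sum fun x _ => hterm x).trans (le_of_eq ?_)
  rw [Finset.sum_add_distrib, Finset.sum_add_distrib, ← Finset.sum_mul, ← Finset.sum_mul,
    ← Finset.sum_mul, hw', hw₀']
  ring

theorem environment_const_le {γ D U X Y n M εp εr Sp Sr N : ℝ} (hγ0 : 0 < γ) (hγ1 : γ < 1)
    (hD : 0 < D) (hD1 : D ≤ 1) (hU : 0 ≤ U) (hX : 0 ≤ X) (hY : 0 ≤ Y) (hn : 0 ≤ n) (hM : 0 ≤ M)
    (hεp : 0 < εp) (hεr : 0 < εr) (hSp : 0 < Sp) (hSr : 0 < Sr)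
    (hN : (1 - γ) * N ≤ γ * (X * U + Y * (εp * U))) :
    (Sr + γ * n * (M / (1 - γ)) * Sp) / 2 * U ^ 2
      + (εr + γ * n * (M / (1 - γ)) * εp) * U * (X * U + N + D⁻¹ * N) ≤
    (1 - γ) * ((6 * γ * n * M / (D * (1 - γ) ^ 3) * (εp * (X + γ * εp * Y) + Sp * (1 - γ))
      + (Sr * (1 - γ) + 4 * εr * (X + εp * Y)) / (D ^ 2 * (1 - γ) ^ 2)) / 2 * U ^ 2) := by
  -- Writing `τ` for `1 - γ` turns the denominators into an atom.
  obtain ⟨τ, rfl⟩ : ∃ τ, γ = 1 - τ := ⟨1 - γ, by ring⟩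
  simp only [sub_sub_cancel] at *
  have hτ : 0 < τ := by linarith
  set γ := 1 - τ with hγ
  have hτγ : τ = 1 - γ := by rw [hγ]; ring
  set Z := X + γ * εp * Y with hZ
  have hZ0 : 0 ≤ Z := by positivity
  have hZZ : Z ≤ X + εp * Y := by
    have : γ * (εp * Y) ≤ 1 * (εp * Y) := mul_le_mul_of_nonneg_right hγ1.le (by positivity)
    linarith
  -- The factor 2 is a bound for `D + 1`, which collects the two occurrences of `N` after
  -- multiplication by `D`.
  have hT : X * U + N + D⁻¹ * N ≤ 2 * Z * U / (D * τ) := by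
    rw [le_div_iff₀ (by positivity)]
    have e : (X * U + N + D⁻¹ * N) * (D * τ) = D * τ * (X * U) + (D + 1) * (τ * N) := by
      field_simp
      ring
    rw [e]
    have h1 := mul_le_mul_of_nonneg_left hN (show 0 ≤ D + 1 by linarith)
    have h2 : D * τ * (X * U) + (D + 1) * (γ * (X * U + Y * (εp * U)))
        = (D + 1) * (Z * U) - τ * (X * U) := by
      rw [hZ, hτγ]; ring
    have h3 : (D + 1) * (Z * U) ≤ 2 * (Z * U) :=
      mul_le_mul_of_nonneg_right (by linarith) (by positivity)
    have h4 : 0 ≤ τ * (X * U) := by positivity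
    linarith
  have hDD : D ^ 2 ≤ D := by nlinarith
  have b1 : Sr / 2 * U ^ 2 ≤ Sr * U ^ 2 / (2 * D ^ 2) := by
    rw [le_div_iff₀ (by positivity)]
    have : D ^ 2 * (Sr * U ^ 2) ≤ 1 * (Sr * U ^ 2) :=
      mul_le_mul_of_nonneg_right (by linarith) (by positivity)
    linarith
  have b2 : γ * n * (M / τ) * Sp / 2 * U ^ 2 ≤ 3 * γ * n * M * Sp * U ^ 2 / (D * τ) := by
    rw [le_div_iff₀ (by positivity)]
    have e : γ * n * (M / τ) * Sp / 2 * U ^ 2 * (D * τ) = D * (γ * n * M * Sp * U ^ 2) / 2 := by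
      field_simp
    have h0 : 0 ≤ γ * n * M * Sp * U ^ 2 := by positivity
    have : D * (γ * n * M * Sp * U ^ 2) ≤ 1 * (γ * n * M * Sp * U ^ 2) :=
      mul_le_mul_of_nonneg_right hD1 h0
    linarith
  have b3 : εr * U * (X * U + N + D⁻¹ * N) ≤ 2 * εr * (X + εp * Y) * U ^ 2 / (D ^ 2 * τ) := by
    calc _ ≤ εr * U * (2 * Z * U / (D * τ)) := mul_le_mul_of_nonneg_left hT (by positivity)
      _ = 2 * εr * Z * U ^ 2 / (D * τ) := by ring
      _ ≤ _ := by gcongr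
  have b4 : γ * n * (M / τ) * εp * U * (X * U + N + D⁻¹ * N)
      ≤ 3 * γ * n * M * εp * Z * U ^ 2 / (D * τ ^ 2) := by
    calc _ ≤ γ * n * (M / τ) * εp * U * (2 * Z * U / (D * τ)) :=
          mul_le_mul_of_nonneg_left hT (by positivity)
      _ = 2 * (γ * n * M * εp * Z * U ^ 2) / (D * τ ^ 2) := by field_simp
      _ ≤ 3 * (γ * n * M * εp * Z * U ^ 2) / (D * τ ^ 2) := by
          have : 0 ≤ γ * n * M * εp * Z * U ^ 2 := by positivity
          gcongr
          norm_num
      _ = _ := by ring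
  have e : τ * ((6 * γ * n * M / (D * τ ^ 3) * (εp * Z + Sp * τ)
      + (Sr * τ + 4 * εr * (X + εp * Y)) / (D ^ 2 * τ ^ 2)) / 2 * U ^ 2) =
      Sr * U ^ 2 / (2 * D ^ 2) + 3 * γ * n * M * Sp * U ^ 2 / (D * τ)
      + 2 * εr * (X + εp * Y) * U ^ 2 / (D ^ 2 * τ)
      + 3 * γ * n * M * εp * Z * U ^ 2 / (D * τ ^ 2) := by
    clear_value Z γ
    field_simp
    ring
  rw [e]
  linarith

end ErrorBounds

/-! ### Entropy differences as a linear part minus Bregman divergences. -/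

section Bregman

variable {S A : Type*} [Fintype S] [Fintype A]

/-- The Bregman divergence of `x ↦ x log x`. -/
noncomputable def entropyBregman (x y : ℝ) : ℝ := x * (Real.log x - Real.log y) - (x - y)

/-- The derivative of `-x log x` is `-log x - 1`; the constant `-1` drops out because both rows sum
to 1. -/
theorem sum_entropy_sub {π₀ π : SAVec S A} (hπ₀ : π₀ ∈ policySpace S A)
    (hπ : π ∈ policySpace S A) (k : S × A → ℝ) (lam : ℝ) (s : S) :
    ∑ a, ((π (s, a) - π₀ (s, a)) * k (s, a)
      + lam * (Real.negMulLog (π (s, a)) - Real.negMulLog (π₀ (s, a)))) =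
    ∑ a, (π - π₀) (s, a) * (k (s, a) - lam * Real.log (π₀ (s, a)))
      - lam * ∑ a, entropyBregman (π (s, a)) (π₀ (s, a)) := by
  have h : lam * ∑ a, (π (s, a) - π₀ (s, a)) = 0 := by
    rw [Finset.sum_sub_distrib, hπ.2, hπ₀.2, sub_self, mul_zero]
  rw [← sub_eq_zero, ← neg_eq_zero, ← h, Finset.mul_sum, Finset.mul_sum, ← Finset.sum_sub_distrib,
    ← Finset.sum_sub_distrib, ← Finset.sum_neg_distrib]
  refine Finset.sum_congr rfl fun a _ => ?_
  simp only [entropyBregman, Real.negMulLog, PiLp.sub_apply]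
  ring

end Bregman

/-! ### Gradient and dominance for the performative value. -/

section Performative

variable {S A : Type*} [Fintype S] [Fintype A]
  [MeasurableSpace S] [DiscreteMeasurableSpace S]
  [MeasurableSpace A] [DiscreteMeasurableSpace A]

/-- The standing assumptions on a performative environment: sensitivity, smoothness and a lower
bound on the state occupancy. -/
structure IsRegularEnvironment (γ lam : ℝ) (ρ : S → ℝ) (p : SAVec S A → KernelVec S A)
    (r : SAVec S A → SAVec S A) (εp εr Sp Sr D : ℝ) : Prop where
  γ_pos : 0 < γ
  γ_lt_one : γ < 1
  lam_nonneg : 0 ≤ lam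
  init_mem : ρ ∈ stdSimplex ℝ S
  kernel_mem : ∀ π ∈ policySpace S A, p π ∈ kernelSpace S A
  reward_mem : ∀ π ∈ policySpace S A, r π ∈ rewardSpace S A
  εp_pos : 0 < εp
  εr_pos : 0 < εr
  Sp_pos : 0 < Sp
  Sr_pos : 0 < Sr
  D_pos : 0 < D
  sens_p : ∀ π ∈ policySpace S A, ∀ π' ∈ policySpace S A, ‖p π' - p π‖ ≤ εp * ‖π' - π‖
  sens_r : ∀ π ∈ policySpace S A, ∀ π' ∈ policySpace S A, ‖r π' - r π‖ ≤ εr * ‖π' - π‖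
  smooth_p : ∀ s a s', LipschitzSmoothOn (fun π => p π (s, a, s')) (policySpace S A) Sp
  smooth_r : ∀ s a, LipschitzSmoothOn (fun π => r π (s, a)) (policySpace S A) Sr
  occ : ∀ π ∈ policySpace S A, ∀ q ∈ kernelSpace S A, ∀ s, D ≤ stateOccupancy γ ρ π q s

namespace IsRegularEnvironment

variable {γ lam : ℝ} {ρ : S → ℝ} {p : SAVec S A → KernelVec S A}
  {r : SAVec S A → SAVec S A} {εp εr Sp Sr D : ℝ} {π₀ π : SAVec S A}

theorem exists_bellman (h : IsRegularEnvironment γ lam ρ p r εp εr Sp Sr D)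
    (hπ₀ : π₀ ∈ policySpace S A) : ∃ V : S → ℝ, IsBellmanSolution γ lam π₀ (p π₀) (r π₀) V ∧
      ∀ s, |V s| ≤ (1 + lam * Real.log (Fintype.card A)) / (1 - γ) := by
  obtain ⟨V, hV⟩ := exists_isBellmanSolution h.γ_pos h.γ_lt_one hπ₀ (h.kernel_mem _ hπ₀) (r π₀) lam
  refine ⟨V, hV, fun s => ?_⟩
  have hb := hV.bounds h.γ_pos h.γ_lt_one h.lam_nonneg hπ₀ (h.kernel_mem _ hπ₀)
    (h.reward_mem _ hπ₀) s
  rw [abs_of_nonneg hb.1]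
  exact hb.2

theorem D_le_one (h : IsRegularEnvironment γ lam ρ p r εp εr Sp Sr D)
    (hπ₀ : π₀ ∈ policySpace S A) : D ≤ 1 := by
  obtain ⟨s⟩ : Nonempty S := by
    by_contra hS
    rw [not_nonempty_iff] at hS
    simpa using h.init_mem.2
  exact (h.occ π₀ hπ₀ _ (h.kernel_mem _ hπ₀) s).trans
    (stateOccupancy_le_one h.γ_pos h.γ_lt_one h.init_mem hπ₀ (h.kernel_mem _ hπ₀) s)

theorem sum_abs_stateOccupancy_sub_le (h : IsRegularEnvironment γ lam ρ p r εp εr Sp Sr D)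
    (hπ₀ : π₀ ∈ policySpace S A) (hπ : π ∈ policySpace S A) :
    (1 - γ) * ∑ s, |stateOccupancy γ ρ π (p π) s - stateOccupancy γ ρ π₀ (p π₀) s| ≤
      γ * (√(Fintype.card A) * ‖π - π₀‖ + √(Fintype.card S) * (εp * ‖π - π₀‖)) := by
  refine (_root_.sum_abs_stateOccupancy_sub_le h.γ_pos h.γ_lt_one h.init_mem hπ₀
    (h.kernel_mem _ hπ₀) hπ (h.kernel_mem _ hπ)).trans ?_
  have := h.sens_p _ hπ₀ _ hπ
  have := h.γ_pos
  gcongr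

theorem performativeValue_sub (h : IsRegularEnvironment γ lam ρ p r εp εr Sp Sr D)
    (hπ₀ : π₀ ∈ policySpace S A) (hπ : π ∈ policySpace S A) {V : S → ℝ}
    (hV : IsBellmanSolution γ lam π₀ (p π₀) (r π₀) V) :
    (1 - γ) * (performativeValue γ lam ρ p r π - performativeValue γ lam ρ p r π₀) =
      ∑ s, stateOccupancy γ ρ π (p π) s * ∑ a, (π - π₀) (s, a)
        * (oneStepReturn γ (p π₀) (r π₀) V (s, a) - lam * Real.log (π₀ (s, a)))
      - lam * ∑ s, stateOccupancy γ ρ π (p π) s * ∑ a, entropyBregman (π (s, a)) (π₀ (s, a))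
      + ∑ x, occupancy γ ρ π (p π) x * (oneStepReturn γ (p π) (r π) V x
        - oneStepReturn γ (p π₀) (r π₀) V x) := by
  rw [performativeValue, performativeValue, entropyValue_sub h.γ_pos h.γ_lt_one h.init_mem (r π)
    hπ₀ (h.kernel_mem _ hπ₀) hπ (h.kernel_mem _ hπ) hV]
  simp only [sum_entropy_sub hπ₀ hπ, mul_sub (stateOccupancy _ _ _ _ _), Finset.sum_sub_distrib]
  congr 2
  rw [Finset.mul_sum]
  exact Finset.sum_congr rfl fun s _ => by ring

/-- The vector `v` is `π - π₀` with row `s` rescaled by the ratio of the new to the old state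
occupancy. The factor `D` makes `π₀ + D • v` feasible: occupancies lie between `D` and 1. -/
theorem exists_gradient_and_dominance (h : IsRegularEnvironment γ lam ρ p r εp εr Sp Sr D)
    (hπ₀ : π₀ ∈ policySpace S A) (hpos : lam = 0 ∨ ∀ x, 0 < π₀ x) :
    ∃ g, HasGradientWithinAt (performativeValue γ lam ρ p r) g (policySpace S A) π₀ ∧
      ∀ π ∈ policySpace S A, ∃ v, π₀ + D • v ∈ policySpace S A ∧
        performativeValue γ lam ρ p r π ≤ performativeValue γ lam ρ p r π₀ + inner ℝ g v
          - gradDomConst γ lam D εp εr Sp Sr (Fintype.card S) (Fintype.card A) / 2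
            * ‖π - π₀‖ ^ 2 := by
  obtain ⟨V, hV, hVM⟩ := h.exists_bellman hπ₀
  choose G hG using exists_gradient_oneStepReturn h.γ_pos h.sens_p h.sens_r h.smooth_p h.smooth_r
    hVM hπ₀
  have hγ0 := h.γ_pos
  have hγ1 := h.γ_lt_one
  have hτ : 0 < 1 - γ := sub_pos.2 hγ1
  have hlam := h.lam_nonneg
  have hM : 0 ≤ 1 + lam * Real.log (Fintype.card A) :=
    add_nonneg zero_le_one (mul_nonneg hlam (Real.log_natCast_nonneg _))
  have hεp := h.εp_pos
  have hεr := h.εr_pos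
  have hp₀ := h.kernel_mem _ hπ₀
  set k := fun π => oneStepReturn γ (p π) (r π) V with hk
  set l : S × A → ℝ := fun x => k π₀ x - lam * Real.log (π₀ x) with hl
  set d : SAVec S A → S → ℝ := fun π => stateOccupancy γ ρ π (p π) with hd
  set w : SAVec S A → S × A → ℝ := fun π => occupancy γ ρ π (p π) with hw
  set K := Sr + γ * Fintype.card S * ((1 + lam * Real.log (Fintype.card A)) / (1 - γ)) * Sp
  set ε := εr + γ * Fintype.card S * ((1 + lam * Real.log (Fintype.card A)) / (1 - γ)) * εp
    with hε
  have hε0 : 0 ≤ ε := by positivity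
  -- The candidate for `1 - γ` times the gradient: the usual policy gradient, plus the response of
  -- the environment averaged over the occupancy of `π₀`.
  let g' : SAVec S A := WithLp.toLp 2 (fun x => d π₀ x.1 * l x) + ∑ x, w π₀ x • G x
  have hg' (v : SAVec S A) : inner ℝ g' v =
      ∑ s, d π₀ s * ∑ a, v (s, a) * l (s, a) + ∑ x, w π₀ x * inner ℝ (G x) v := by
    simp only [g', inner_add_left, sum_inner, real_inner_smul_left]
    congr 1
    rw [PiLp.inner_apply, Fintype.sum_prod_type]
    refine Finset.sum_congr rfl fun s _ => ?_
    rw [Finset.mul_sum]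
    refine Finset.sum_congr rfl fun a _ => ?_
    simp
    ring
  have hval (π) (hπ : π ∈ policySpace S A) : (1 - γ) * (performativeValue γ lam ρ p r π
      - performativeValue γ lam ρ p r π₀) = ∑ s, d π s * ∑ a, (π - π₀) (s, a) * l (s, a)
      - lam * ∑ s, d π s * ∑ a, entropyBregman (π (s, a)) (π₀ (s, a))
      + ∑ x, w π x * (k π x - k π₀ x) := h.performativeValue_sub hπ₀ hπ hV
  have hd0 (π : SAVec S A) (s : S) : 0 ≤ d π s := stateOccupancy_nonneg hγ0 hγ1 s
  have hd1 (π) (hπ : π ∈ policySpace S A) (s : S) : d π s ≤ 1 :=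
    stateOccupancy_le_one hγ0 hγ1 h.init_mem hπ (h.kernel_mem _ hπ) s
  have hdD (π) (hπ : π ∈ policySpace S A) (s : S) : D ≤ d π s :=
    h.occ π hπ _ (h.kernel_mem _ hπ) s
  have hw0 (π : SAVec S A) (x) : 0 ≤ w π x := occupancy_nonneg hγ0 hγ1 x
  have hw1 (π) (hπ : π ∈ policySpace S A) : ∑ x, w π x = 1 :=
    sum_occupancy hγ0 hγ1 h.init_mem hπ (h.kernel_mem _ hπ)
  have hN (π) (hπ : π ∈ policySpace S A) : (1 - γ) * ∑ s, |d π s - d π₀ s| ≤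
      γ * (√(Fintype.card A) * ‖π - π₀‖ + √(Fintype.card S) * (εp * ‖π - π₀‖)) :=
    h.sum_abs_stateOccupancy_sub_le hπ₀ hπ
  have hNw (π) (hπ : π ∈ policySpace S A) : ∑ x, |w π x - w π₀ x| ≤
      √(Fintype.card A) * ‖π - π₀‖ + ∑ s, |d π s - d π₀ s| :=
    sum_abs_occupancy_sub_le hγ0 hγ1 h.init_mem hπ₀ hp₀ hπ (h.kernel_mem _ hπ)
  refine ⟨(1 - γ)⁻¹ • g', ?_, fun π hπ => ?_⟩
  · set c := γ * (√(Fintype.card A) + √(Fintype.card S) * εp) / (1 - γ) with hc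
    refine hasGradientWithinAt_of_quadratic_bound (C := (1 - γ)⁻¹ * (c * ∑ x, |l x|
      + lam * ∑ x, (π₀ x)⁻¹ + K / 2 + (√(Fintype.card A) + c) * ε)) fun π hπ => ?_
    -- Every summand on the right is of second order: a product of two increments, a Bregman
    -- divergence or a linearization error.
    have e : performativeValue γ lam ρ p r π - performativeValue γ lam ρ p r π₀
        - inner ℝ ((1 - γ)⁻¹ • g') (π - π₀) = (1 - γ)⁻¹ * (
        ∑ s, (d π s - d π₀ s) * ∑ a, (π - π₀) (s, a) * l (s, a)
        - lam * ∑ s, d π s * ∑ a, entropyBregman (π (s, a)) (π₀ (s, a))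
        + ∑ x, w π x * (k π x - k π₀ x - inner ℝ (G x) (π - π₀))
        + ∑ x, (w π x - w π₀ x) * inner ℝ (G x) (π - π₀)) := by
      have h1 := hval π hπ
      have h2 := hg' (π - π₀)
      rw [real_inner_smul_left, eq_inv_mul_iff_mul_eq₀ hτ.ne', mul_sub,
        mul_inv_cancel_left₀ hτ.ne', h1, h2]
      simp only [sub_mul (d π _), sub_mul (w π _), mul_sub (w π _), Finset.sum_sub_distrib]
      ring
    rw [e, abs_mul, abs_of_pos (inv_pos.2 hτ), mul_assoc]
    refine mul_le_mul_of_nonneg_left ?_ (inv_pos.2 hτ).le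
    set U := ‖π - π₀‖ with hU
    have hU0 : 0 ≤ U := norm_nonneg _
    have hNc : ∑ s, |d π s - d π₀ s| ≤ c * U := by
      rw [hc, div_mul_eq_mul_div, le_div_iff₀ hτ]
      have := hN π hπ
      linarith
    have b1 : |∑ s, (d π s - d π₀ s) * ∑ a, (π - π₀) (s, a) * l (s, a)| ≤
        c * U * (U * ∑ x, |l x|) := by
      calc _ ≤ ∑ s, |d π s - d π₀ s| * (U * ∑ x, |l x|) := by
            refine (Finset.abs_sum_le_sum_abs _ _).trans (Finset.sum_le_sum fun s _ => ?_)
            rw [abs_mul]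
            refine mul_le_mul_of_nonneg_left ?_ (abs_nonneg _)
            rw [Fintype.sum_prod_type, Finset.mul_sum]
            calc _ ≤ ∑ a, U * |l (s, a)| :=
                  (Finset.abs_sum_le_sum_abs _ _).trans (Finset.sum_le_sum fun a _ => by
                    rw [abs_mul]
                    exact mul_le_mul_of_nonneg_right (abs_apply_le_norm _ _) (abs_nonneg _))
              _ = U * ∑ a, |l (s, a)| := by rw [Finset.mul_sum]
              _ ≤ _ := Finset.single_le_sum (f := fun s => U * ∑ a, |l (s, a)|)
                  (fun s _ => by positivity) (Finset.mem_univ s)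
        _ ≤ _ := by
            rw [← Finset.sum_mul]
            exact mul_le_mul_of_nonneg_right hNc (by positivity)
    have b2 : |lam * ∑ s, d π s * ∑ a, entropyBregman (π (s, a)) (π₀ (s, a))| ≤
        lam * ((∑ x, (π₀ x)⁻¹) * U ^ 2) := by
      rw [abs_mul, abs_of_nonneg hlam]
      rcases hpos with rfl | hpos
      · simp
      refine mul_le_mul_of_nonneg_left ?_ hlam
      rw [Finset.sum_mul, Fintype.sum_prod_type]
      refine (Finset.abs_sum_le_sum_abs _ _).trans (Finset.sum_le_sum fun s _ => ?_)
      rw [abs_mul, abs_of_nonneg (hd0 _ _)]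
      refine (mul_le_of_le_one_left (abs_nonneg _) (hd1 π hπ s)).trans ?_
      refine (Finset.abs_sum_le_sum_abs _ _).trans (Finset.sum_le_sum fun a _ => ?_)
      have hlow := half_sq_sub_le_bregman (hπ.1 (s, a)) (policySpace_le_one hπ (s, a)) (hpos (s, a))
        (policySpace_le_one hπ₀ (s, a))
      rw [entropyBregman, abs_of_nonneg ((by positivity : (0 : ℝ) ≤ _).trans hlow)]
      refine (bregman_le_sq_div (hπ.1 _) (hpos _)).trans ?_
      rw [div_eq_inv_mul]
      refine mul_le_mul_of_nonneg_left ?_ (inv_pos.2 (hpos _)).le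
      rw [← sq_abs]
      exact pow_le_pow_left₀ (abs_nonneg _) (abs_apply_le_norm (π - π₀) (s, a)) 2
    have b3 : |∑ x, w π x * (k π x - k π₀ x - inner ℝ (G x) (π - π₀))| ≤ K / 2 * U ^ 2 := by
      calc _ ≤ ∑ x, w π x * (K / 2 * U ^ 2) :=
            (Finset.abs_sum_le_sum_abs _ _).trans (Finset.sum_le_sum fun x _ => by
              rw [abs_mul, abs_of_nonneg (hw0 _ _)]
              exact mul_le_mul_of_nonneg_left (hG x π hπ).1 (hw0 _ _))
        _ = _ := by rw [← Finset.sum_mul, hw1 π hπ, one_mul]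
    have b4 : |∑ x, (w π x - w π₀ x) * inner ℝ (G x) (π - π₀)| ≤
        (√(Fintype.card A) * U + c * U) * (ε * U) := by
      calc _ ≤ ∑ x, |w π x - w π₀ x| * (ε * U) :=
            (Finset.abs_sum_le_sum_abs _ _).trans (Finset.sum_le_sum fun x _ => by
              rw [abs_mul]
              exact mul_le_mul_of_nonneg_left (hG x π hπ).2 (abs_nonneg _))
        _ ≤ _ := by
            rw [← Finset.sum_mul]
            exact mul_le_mul_of_nonneg_right ((hNw π hπ).trans (by linarith)) (by positivity)
    refine (abs_add_le _ _).trans ((add_le_add_left ((abs_add_le _ _).trans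
      (add_le_add_left (abs_sub _ _) _)) _).trans ?_)
    linarith
  · set u := π - π₀ with hu
    have hdpos (s : S) : 0 < d π₀ s := h.D_pos.trans_le (hdD π₀ hπ₀ s)
    refine ⟨∑ s, (d π s / d π₀ s) • rowPart s u, ?_, ?_⟩
    · rw [Finset.smul_sum]
      simp only [smul_smul]
      refine add_sum_smul_rowPart_mem_policySpace hπ₀ hπ fun s =>
        ⟨mul_nonneg h.D_pos.le (div_nonneg (hd0 _ _) (hd0 _ _)), ?_⟩
      rw [mul_div_assoc', div_le_one (hdpos s)]
      exact (mul_le_of_le_one_right h.D_pos.le (hd1 π hπ s)).trans (hdD π₀ hπ₀ s)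
    have hin : inner ℝ g' (∑ s, (d π s / d π₀ s) • rowPart s u) =
        ∑ s, d π s * ∑ a, u (s, a) * l (s, a)
        + ∑ x, w π₀ x * inner ℝ (G x) (∑ s, (d π s / d π₀ s) • rowPart s u) := by
      rw [hg']
      congr 1
      refine Finset.sum_congr rfl fun s _ => ?_
      simp only [sum_smul_rowPart_apply, mul_assoc, ← Finset.mul_sum]
      rw [← mul_assoc, mul_div_cancel₀ _ (hdpos s).ne']
    have hbreg : lam * (D * (‖u‖ ^ 2 / 2)) ≤
        lam * ∑ s, d π s * ∑ a, entropyBregman (π (s, a)) (π₀ (s, a)) := by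
      rcases hpos with rfl | hpos
      · simp
      refine mul_le_mul_of_nonneg_left ?_ hlam
      rw [EuclideanSpace.norm_sq_eq, Fintype.sum_prod_type, Finset.sum_div, Finset.mul_sum]
      refine Finset.sum_le_sum fun s _ => ?_
      refine mul_le_mul (hdD π hπ s) ?_ (by positivity) (hd0 _ _)
      rw [Finset.sum_div]
      refine Finset.sum_le_sum fun a _ => ?_
      rw [Real.norm_eq_abs, sq_abs]
      exact half_sq_sub_le_bregman (hπ.1 (s, a)) (policySpace_le_one hπ (s, a)) (hpos (s, a))
        (policySpace_le_one hπ₀ (s, a))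
    have herr := environment_error_le hπ₀ hπ (d₀ := d π₀) (d := d π) (w₀ := w π₀) (w := w π)
      (Δ := fun x => k π x - k π₀ x) h.D_pos hε0 (hdD π₀ hπ₀) (hw0 _) (hw1 π₀ hπ₀) (hw0 _)
      (hw1 π hπ) (fun x => (hG x π hπ).1) (fun x y hy => (hG x y hy).2)
    have hconst := environment_const_le (U := ‖u‖) (X := √(Fintype.card A))
      (Y := √(Fintype.card S)) (n := Fintype.card S) (Sp := Sp) (Sr := Sr) hγ0 hγ1 h.D_pos
      (h.D_le_one hπ₀)
      (norm_nonneg _) (Real.sqrt_nonneg _) (Real.sqrt_nonneg _) (Nat.cast_nonneg _) hM hεp hεr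
      h.Sp_pos h.Sr_pos (hN π hπ)
    have hmono : ε * ‖u‖ * (∑ x, |w π x - w π₀ x| + D⁻¹ * ∑ s, |d π s - d π₀ s|) ≤
        ε * ‖u‖ * (√(Fintype.card A) * ‖u‖ + ∑ s, |d π s - d π₀ s|
          + D⁻¹ * ∑ s, |d π s - d π₀ s|) :=
      mul_le_mul_of_nonneg_left (add_le_add_left (hNw π hπ) _) (by positivity)
    have hv := hval π hπ
    rw [real_inner_smul_left, hin]
    refine le_of_mul_le_mul_left ?_ hτ
    set J := ∑ x, w π₀ x * inner ℝ (G x) (∑ s, (d π s / d π₀ s) • rowPart s u)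
    set T := ∑ s, d π s * ∑ a, u (s, a) * l (s, a)
    have e : (1 - γ) * (performativeValue γ lam ρ p r π₀ + (1 - γ)⁻¹ * (T + J)
        - gradDomConst γ lam D εp εr Sp Sr (Fintype.card S) (Fintype.card A) / 2 * ‖u‖ ^ 2) =
        (1 - γ) * performativeValue γ lam ρ p r π₀ + T + J - lam * (D * (‖u‖ ^ 2 / 2))
        + (1 - γ) * ((6 * γ * Fintype.card S * (1 + lam * Real.log (Fintype.card A))
          / (D * (1 - γ) ^ 3) * (εp * (√(Fintype.card A) + γ * εp * √(Fintype.card S))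
            + Sp * (1 - γ))
          + (Sr * (1 - γ) + 4 * εr * (√(Fintype.card A) + εp * √(Fintype.card S)))
            / (D ^ 2 * (1 - γ) ^ 2)) / 2 * ‖u‖ ^ 2) := by
      have e1 : (1 - γ) * ((1 - γ)⁻¹ * (T + J)) = T + J := mul_inv_cancel_left₀ hτ.ne' _
      have e2 : (1 - γ) * (D * lam / (1 - γ)) = D * lam := mul_div_cancel₀ _ hτ.ne'
      rw [gradDomConst]
      linear_combination e1 - ‖u‖ ^ 2 / 2 * e2
    rw [e]
    linarith

/-- Moving mass onto a zero entry gains entropy `-t log t`, weighted by at least `D λ`; every other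
contribution is bounded below by a multiple of `-t`. -/
theorem exists_tendsto_atTop (h : IsRegularEnvironment γ lam ρ p r εp εr Sp Sr D)
    (hπ₀ : π₀ ∈ policySpace S A) (hlam : 0 < lam) (hzero : ∃ x, π₀ x = 0) :
    ∃ π ∈ policySpace S A,
      Tendsto (fun t : ℝ => (performativeValue γ lam ρ p r (π₀ + t • (π - π₀))
        - performativeValue γ lam ρ p r π₀) / t) (𝓝[>] 0) atTop := by
  classical
  obtain ⟨⟨s₀, a₀⟩, hx₀⟩ := hzero
  obtain ⟨V, hV, hVM⟩ := h.exists_bellman hπ₀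
  choose G hG using exists_gradient_oneStepReturn h.γ_pos h.sens_p h.sens_r h.smooth_p h.smooth_r
    hVM hπ₀
  have hγ0 := h.γ_pos
  have hγ1 := h.γ_lt_one
  have hτ : 0 < 1 - γ := sub_pos.2 hγ1
  have hp₀ := h.kernel_mem _ hπ₀
  set k := fun π => oneStepReturn γ (p π) (r π) V with hk
  set K := Sr + γ * Fintype.card S * ((1 + lam * Real.log (Fintype.card A)) / (1 - γ)) * Sp
  set ε := εr + γ * Fintype.card S * ((1 + lam * Real.log (Fintype.card A)) / (1 - γ)) * εp
  have hM : 0 ≤ 1 + lam * Real.log (Fintype.card A) :=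
    add_nonneg zero_le_one (mul_nonneg hlam.le (Real.log_natCast_nonneg _))
  have hK0 : 0 ≤ K := by
    have := h.Sp_pos
    have := h.Sr_pos
    positivity
  have hε0 : 0 ≤ ε := by
    have := h.εp_pos
    have := h.εr_pos
    positivity
  -- Always playing `a₀` makes the entry at `(s₀, a₀)` equal to `t` along the segment.
  let π : SAVec S A := WithLp.toLp 2 fun x => if x.2 = a₀ then 1 else 0
  have hπ : π ∈ policySpace S A :=
    ⟨fun x => by simp only [π]; split_ifs <;> norm_num, fun s => by simp [π]⟩
  refine ⟨π, hπ, ?_⟩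
  set W := ‖π - π₀‖ with hW
  have hW0 : 0 ≤ W := norm_nonneg _
  set C := ∑ x : S × A, (W * |k π₀ x| + lam) + (K / 2 * W ^ 2 + ε * W) with hC
  have key : ∀ t ∈ Ioc (0 : ℝ) 1, (1 - γ)⁻¹ * (D * lam * -Real.log t - C) ≤
      (performativeValue γ lam ρ p r (π₀ + t • (π - π₀))
        - performativeValue γ lam ρ p r π₀) / t := by
    intro t ht
    set π' := π₀ + t • (π - π₀) with hπ'
    have hmem : π' ∈ policySpace S A :=
      convex_policySpace.add_smul_sub_mem hπ₀ hπ ⟨ht.1.le, ht.2⟩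
    have hval : (1 - γ) * (performativeValue γ lam ρ p r π' - performativeValue γ lam ρ p r π₀) = _ :=
      entropyValue_sub hγ0 hγ1 h.init_mem (r π') hπ₀ hp₀ hmem (h.kernel_mem _ hmem) hV
    have hnorm : ‖π' - π₀‖ = t * W := by
      rw [hπ', add_sub_cancel_left, norm_smul, Real.norm_of_nonneg ht.1.le]
    have happ (x : S × A) : π' x - π₀ x = t * (π - π₀) x := by
      simp [hπ']
    -- By concavity and `-x log x ≤ 1`, no entry loses more than `t` of entropy.
    have hent (x : S × A) : -t ≤ Real.negMulLog (π' x) - Real.negMulLog (π₀ x) := by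
      have h1 := Real.concaveOn_negMulLog.2 (mem_Ici.2 (hπ₀.1 x)) (mem_Ici.2 (hπ.1 x))
        (sub_nonneg.2 ht.2) ht.1.le (by ring)
      have e : (1 - t) • π₀ x + t • π x = π' x := by
        simp [hπ']; ring
      rw [e, smul_eq_mul, smul_eq_mul] at h1
      have h2 := Real.negMulLog_nonneg (hπ.1 x) (policySpace_le_one hπ x)
      have h3 : Real.negMulLog (π₀ x) ≤ 1 := by
        have := Real.negMulLog_le_one_sub_self (hπ₀.1 x)
        have := hπ₀.1 x
        linarith
      have h4 := mul_le_mul_of_nonneg_left h3 ht.1.le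
      have h5 := mul_nonneg ht.1.le h2
      linarith
    have hent₀ : Real.negMulLog (π' (s₀, a₀)) - Real.negMulLog (π₀ (s₀, a₀))
        = Real.negMulLog t := by
      have : π' (s₀, a₀) = t := by simp [hπ', hx₀, π]
      rw [this, hx₀, Real.negMulLog_zero, sub_zero]
    have hnl : 0 ≤ Real.negMulLog t := Real.negMulLog_nonneg ht.1.le ht.2
    have hterm (x : S × A) : (if x = (s₀, a₀) then D * lam * Real.negMulLog t else 0)
        - t * (W * |k π₀ x| + lam) ≤ stateOccupancy γ ρ π' (p π') x.1 *
          ((π' x - π₀ x) * k π₀ x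
            + lam * (Real.negMulLog (π' x) - Real.negMulLog (π₀ x))) := by
      have hd0 := stateOccupancy_nonneg (ρ := ρ) (π := π') (p := p π') hγ0 hγ1 x.1
      have hd1 := stateOccupancy_le_one hγ0 hγ1 h.init_mem hmem (h.kernel_mem _ hmem) x.1
      have hdD := h.occ π' hmem _ (h.kernel_mem _ hmem) x.1
      set δ := stateOccupancy γ ρ π' (p π') x.1
      have h1 : -(t * (W * |k π₀ x|)) ≤ (π' x - π₀ x) * k π₀ x := by
        refine neg_le_of_abs_le ?_
        rw [happ, abs_mul, abs_mul, abs_of_pos ht.1, mul_assoc]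
        exact mul_le_mul_of_nonneg_left (mul_le_mul_of_nonneg_right
          (abs_apply_le_norm (π - π₀) x) (abs_nonneg _)) ht.1.le
      have h2 := mul_le_mul_of_nonneg_left h1 hd0
      have h3 : δ * (t * (W * |k π₀ x|)) ≤ 1 * (t * (W * |k π₀ x|)) :=
        mul_le_mul_of_nonneg_right hd1 (by have := ht.1; positivity)
      have h4 : (if x = (s₀, a₀) then D * lam * Real.negMulLog t else 0) - t * lam ≤
          δ * (lam * (Real.negMulLog (π' x) - Real.negMulLog (π₀ x))) := by
        split_ifs with hx
        · rw [hx, hent₀, ← mul_assoc]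
          have : D * (lam * Real.negMulLog t) ≤ δ * (lam * Real.negMulLog t) :=
            mul_le_mul_of_nonneg_right hdD (by positivity)
          have := mul_pos ht.1 hlam
          linarith
        · have h5 := mul_le_mul_of_nonneg_left (hent x) (mul_nonneg hd0 hlam.le)
          have h6 : δ * (t * lam) ≤ 1 * (t * lam) :=
            mul_le_mul_of_nonneg_right hd1 (mul_pos ht.1 hlam).le
          linarith
      linarith
    have hsum1 : D * lam * Real.negMulLog t - t * ∑ x : S × A, (W * |k π₀ x| + lam) ≤
        ∑ s, stateOccupancy γ ρ π' (p π') s * ∑ a, ((π' (s, a) - π₀ (s, a)) * k π₀ (s, a)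
          + lam * (Real.negMulLog (π' (s, a)) - Real.negMulLog (π₀ (s, a)))) := by
      have := Finset.sum_le_sum fun x (_ : x ∈ Finset.univ) => hterm x
      rw [Finset.sum_sub_distrib, Finset.sum_ite_eq' Finset.univ, if_pos (Finset.mem_univ _),
        ← Finset.mul_sum, Fintype.sum_prod_type
          (f := fun x => stateOccupancy γ ρ π' (p π') x.1 * _)] at this
      simpa only [Finset.mul_sum] using this
    have hsum2 : -(t * (K / 2 * W ^ 2 + ε * W)) ≤
        ∑ x, occupancy γ ρ π' (p π') x * (k π' x - k π₀ x) := by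
      refine neg_le_of_abs_le ?_
      calc _ ≤ ∑ x, occupancy γ ρ π' (p π') x * (t * (K / 2 * W ^ 2 + ε * W)) := by
            refine (Finset.abs_sum_le_sum_abs _ _).trans (Finset.sum_le_sum fun x _ => ?_)
            have hw0 := occupancy_nonneg (ρ := ρ) (π := π') (p := p π') hγ0 hγ1 x
            rw [abs_mul, abs_of_nonneg hw0]
            refine mul_le_mul_of_nonneg_left ?_ hw0
            obtain ⟨h1, h2⟩ := hG x π' hmem
            rw [hnorm] at h1 h2
            have h3 : |k π' x - k π₀ x| ≤ K / 2 * (t * W) ^ 2 + ε * (t * W) := by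
              have := abs_add_le (k π' x - k π₀ x - inner ℝ (G x) (π' - π₀))
                (inner ℝ (G x) (π' - π₀))
              rw [sub_add_cancel] at this
              linarith
            have h4 : t * (t * (K / 2 * W ^ 2)) ≤ 1 * (t * (K / 2 * W ^ 2)) :=
              mul_le_mul_of_nonneg_right ht.2 (by have := ht.1; positivity)
            linarith
        _ = _ := by
            rw [← Finset.sum_mul, sum_occupancy hγ0 hγ1 h.init_mem hmem (h.kernel_mem _ hmem),
              one_mul]
    rw [le_div_iff₀ ht.1]
    refine le_of_mul_le_mul_left ?_ hτ
    rw [hval, mul_assoc (1 - γ)⁻¹, mul_inv_cancel_left₀ hτ.ne']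
    have e : (D * lam * -Real.log t - C) * t = D * lam * Real.negMulLog t
        - t * ∑ x : S × A, (W * |k π₀ x| + lam) + -(t * (K / 2 * W ^ 2 + ε * W)) := by
      rw [hC, Real.negMulLog]; ring
    rw [e]
    exact add_le_add hsum1 hsum2
  refine tendsto_atTop_mono' _ (Filter.mem_of_superset (Ioc_mem_nhdsGT zero_lt_one) key) ?_
  refine Tendsto.const_mul_atTop (inv_pos.2 hτ) (tendsto_atTop_add_const_right _ (-C) ?_)
  exact (tendsto_neg_atBot_atTop.comp Real.tendsto_log_nhdsGT_zero).const_mul_atTop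
    (mul_pos h.D_pos hlam)

end IsRegularEnvironment

end Performative
theorem theorem1 {S A : Type*} [Fintype S] [Fintype A]
    [MeasurableSpace S] [DiscreteMeasurableSpace S]
    [MeasurableSpace A] [DiscreteMeasurableSpace A]
    (γ lam : ℝ) (hγ0 : 0 < γ) (hγ1 : γ < 1) (hlam : 0 ≤ lam)
    (ρ : S → ℝ) (hρ : ρ ∈ stdSimplex ℝ S)
    (p : SAVec S A → KernelVec S A) (r : SAVec S A → SAVec S A)
    (hp : ∀ π ∈ policySpace S A, p π ∈ kernelSpace S A)
    (hr : ∀ π ∈ policySpace S A, r π ∈ rewardSpace S A)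
    (εp εr Sp Sr D : ℝ) (hεp : 0 < εp) (hεr : 0 < εr) (hSp : 0 < Sp) (hSr : 0 < Sr) (hD : 0 < D)
    -- sensitivity
    (hsens_p : ∀ π ∈ policySpace S A, ∀ π' ∈ policySpace S A, ‖p π' - p π‖ ≤ εp * ‖π' - π‖)
    (hsens_r : ∀ π ∈ policySpace S A, ∀ π' ∈ policySpace S A, ‖r π' - r π‖ ≤ εr * ‖π' - π‖)
    -- smoothness
    (hsmooth_p : ∀ s a s', LipschitzSmoothOn (fun π => p π (s, a, s')) (policySpace S A) Sp)
    (hsmooth_r : ∀ s a, LipschitzSmoothOn (fun π => r π (s, a)) (policySpace S A) Sr)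
    -- lower bound on the state occupancy
    (hocc : ∀ π ∈ policySpace S A, ∀ q ∈ kernelSpace S A, ∀ s, D ≤ stateOccupancy γ ρ π q s) :
    -- the gradient dominance inequality
    (∀ π₀ ∈ policySpace S A, ∀ g : SAVec S A,
      HasGradientWithinAt (performativeValue γ lam ρ p r) g (policySpace S A) π₀ →
      ∃ m : ℝ, IsGreatest ((fun π => inner ℝ g (π - π₀)) '' policySpace S A) m ∧
        ∀ π₁ ∈ policySpace S A,
          performativeValue γ lam ρ p r π₁ ≤ performativeValue γ lam ρ p r π₀ + D⁻¹ * m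
            - gradDomConst γ lam D εp εr Sp Sr (Fintype.card S) (Fintype.card A) / 2
              * ‖π₁ - π₀‖ ^ 2) ∧
    -- the gradient exists at `π₀` if `lam = 0` or all entries of `π₀` are positive
    (∀ π₀ ∈ policySpace S A, (lam = 0 ∨ ∀ x, 0 < π₀ x) →
      ∃ g, HasGradientWithinAt (performativeValue γ lam ρ p r) g (policySpace S A) π₀) ∧
    -- in the remaining case the maximum is `+∞`: so is a one-sided directional derivative
    (∀ π₀ ∈ policySpace S A, 0 < lam → (∃ x, π₀ x = 0) →
      ∃ π ∈ policySpace S A,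
        Tendsto (fun t : ℝ => (performativeValue γ lam ρ p r (π₀ + t • (π - π₀))
          - performativeValue γ lam ρ p r π₀) / t) (𝓝[>] 0) atTop) := by
  have h : IsRegularEnvironment γ lam ρ p r εp εr Sp Sr D :=
    ⟨hγ0, hγ1, hlam, hρ, hp, hr, hεp, hεr, hSp, hSr, hD, hsens_p, hsens_r, hsmooth_p, hsmooth_r,
      hocc⟩
  refine ⟨fun π₀ hπ₀ g hg => ?_, fun π₀ hπ₀ hpos => ?_, fun π₀ hπ₀ hl hz =>
    h.exists_tendsto_atTop hπ₀ hl hz⟩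
  · obtain ⟨m, hm⟩ := (isCompact_policySpace.image (f := fun π => inner ℝ g (π - π₀))
      (by fun_prop)).exists_isGreatest ⟨_, mem_image_of_mem _ hπ₀⟩
    refine ⟨m, hm, fun π₁ hπ₁ => ?_⟩
    -- A gradient forces finite slopes, which the infinite slope at a zero entry rules out when
    -- `lam` is positive.
    have hpos : lam = 0 ∨ ∀ x, 0 < π₀ x := by
      by_contra! hcon
      obtain ⟨x, hx⟩ := hcon.2
      obtain ⟨π, hπ, htop⟩ := h.exists_tendsto_atTop hπ₀ (hlam.lt_of_ne' hcon.1)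
        ⟨x, le_antisymm hx (hπ₀.1 x)⟩
      exact not_tendsto_nhds_of_tendsto_atTop htop _ (hg.tendsto_slope convex_policySpace hπ₀ hπ)
    obtain ⟨g', hg', hdom⟩ := h.exists_gradient_and_dominance hπ₀ hpos
    obtain ⟨v, hv, hle⟩ := hdom π₁ hπ₁
    -- The given gradient `g` and the constructed `g'` may differ, but they agree on the feasible
    -- direction `D • v`.
    have heq := tendsto_nhds_unique (hg.tendsto_slope convex_policySpace hπ₀ hv)
      (hg'.tendsto_slope convex_policySpace hπ₀ hv)
    have hmax : inner ℝ g (π₀ + D • v - π₀) ≤ m := hm.2 (mem_image_of_mem _ hv)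
    rw [heq, add_sub_cancel_left, real_inner_smul_right] at hmax
    have : inner ℝ g' v ≤ D⁻¹ * m := by
      rwa [inv_mul_eq_div, le_div_iff₀' hD]
    linarith
  · obtain ⟨g, hg, -⟩ := h.exists_gradient_and_dominance hπ₀ hpos
    exact ⟨g, hg⟩
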